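/- **Definitions.** A geometry $(G,I,O)$ is a finite simple graph $G$ with sets $I,O\subseteq V(G)$; write $\sim$ for adjacency, $O^c=V(G)\setminus O$, $I^c=V(G)\setminus I$. A *flow* for $(G,I,O)$ is a pair $(f,\preceq)$ of a function $f:O^c\to I^c$ and a partial order $\preceq$ on $V(G)$ such that for all $v\in O^c$, $w\in V(G)$: $v\sim f(v)$; $v\preceq f(v)$; and $w\sim f(v)$ implies $v\preceq w$. A *path cover* of $(G,I,O)$ is a collection of (possibly trivial) directed paths in $G$ such that every vertex lies on exactly one of them, each path meets $I$ at most in its initial point, and each path meets $O$ exactly in its final point. A *successor function* is an injective $f:O^c\to I^c$ whose maximal orbits form a path cover. Its *natural pre-order* is the reflexive and transitive closure of the relation $\{(v,w): v\in O^c,\ v\neq w,\ w=f(v)\text{ or }w\sim f(v)\}$. A *system of infima* for a pre-order $\preceq$ on $V(G)$ is a triple of arrays $\mathrm{Dist},\mathrm{Path}:V(G)\to\mathbb N$, $\mathrm{Inf}:V(G)\times\mathbb N\to\mathbb Z$ with $v\preceq w\iff \mathrm{Dist}(v)\le \mathrm{Inf}(w,\mathrm{Path}(v))$ for all $v,w\in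 V(G)$. **The procedure $\mathrm{FindFlow}(G,I,O)$.** Let $n=|V(G)|$, $m=|E(G)|$, $k=|O|$. Partial functions are arrays with the extra value $\mathrm{nil}$. 1. If $m>kn-\binom{k+1}{2}$, return $\mathrm{nil}$. 2. Set $\mathrm{iter}=0$ and, for every vertex $v$, $\mathrm{marked}(v)=0$, $f(v)=g(v)=\mathrm{nil}$. Repeat: increment $\mathrm{iter}$, set $\mathrm{found}$ to false, and for $v\in O$ in turn with $v\notin I$ and $g(v)=\mathrm{nil}$ call $\mathrm{Search}(v)$, stopping this pass as soon as $\mathrm{found}$ is true; until a pass ends with $\mathrm{found}$ false. $\mathrm{Search}(v)$: set $\mathrm{marked}(v)=\mathrm{iter}$. If $v\in I$, set $\mathrm{found}$ to true and return. If $w=f(v)\ne\mathrm{nil}$ and $\mathrm{marked}(w)<\mathrm{iter}$, call $\mathrm{Search}(w)$; if then $\mathrm{found}$, set $f(v)=g(v)=\mathrm{nil}$ and return. For each $w\sim v$ in turn with $w\notin O$ and $\mathrm{marked}(w)<\mathrm{iter}$: if $f(w)=\mathrm{nil}$, call $\mathrm{Search}(w)$; otherwise, if $\mathrm{marked}(f(w))<\mathrm{iter}$,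 call $\mathrm{Search}(f(w))$; if a call was made and $\mathrm{found}$ is now true, set $f(w)=v$, $g(v)=w$ and return. 3. If some vertex $v\notin I\cap O$ has $f(v)=g(v)=\mathrm{nil}$, return $\mathrm{nil}$. 4. For the elements $w$ of $O$, numbered $P=1,\dots,k$: for each vertex $u$ of the sequence obtained from $w$ by iterating $g$, starting with its last vertex (where $g$ is $\mathrm{nil}$), set $\mathrm{Dist}(u)=0$ if $g(u)=\mathrm{nil}$ and $\mathrm{Dist}(u)=\mathrm{Dist}(g(u))+1$ otherwise, $\mathrm{Path}(u)=P$, $\mathrm{Inf}(u,P)=\mathrm{Dist}(u)$, $\mathrm{Inf}(u,p)=-1$ for the other $p\in\{1,\dots,k\}$, and $\mathrm{status}(u)=$ untouched. 5. Set $\mathrm{circuit}$ to false. For $w\in O$ in turn call $\mathrm{Infima}(w)$, and return $\mathrm{nil}$ if then $\mathrm{circuit}$ is true. Return $(f,g,(\mathrm{Dist},\mathrm{Path},\mathrm{Inf}))$. $\mathrm{Infima}(w)$: if $w$ is incomplete, set $\mathrm{circuit}$ to true; return unless $w$ is untouched. Make $w$ incomplete. For each $z\sim w$ in turn with $z\ne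 f(w)$ and ($z=g(w)$ or $g(z)\neq\mathrm{nil}$): let $v=z$ if $z=g(w)$ and $v=g(z)$ otherwise; call $\mathrm{Infima}(v)$; return if $\mathrm{circuit}$ is true; replace $\mathrm{Inf}(w,p)$ by $\max(\mathrm{Inf}(w,p),\mathrm{Inf}(v,p))$ for $p=1,\dots,k$. Finally make $w$ complete. The input consists of a list of the vertices, adjacency lists with their lengths, membership tables of $I$ and $O$, and a list of the elements of $O$, all lists in arbitrary order. Time is counted in unit-cost elementary steps (accesses to array entries and variables, tests, loop iterations, calls). **Theorem.** There is a constant $C$ such that the following holds for every geometry $(G,I,O)$ with $|V(G)|=n$ and $|I|=|O|=k$, for every order of the lists in the input. The procedure $\mathrm{FindFlow}(G,I,O)$ terminates, and if $k\ge1$ it does so after at most $C\,k^2n$ steps. It returns $\mathrm{nil}$ if and only if $(G,I,O)$ has no flow. Otherwise it returns a triple $(f,g,(\mathrm{Dist},\mathrm{Path},\mathrm{Inf}))$ where $f$ is a successor function for $(G,I,O)$, $g$ is the inverse of $f$, and $(\mathrm{Dist},\mathrm{Path},\mathrm{Inf})$ is a system of infima for the natural pre-order $\preceq$ of $f$; moreover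 $(f,\preceq)$ is a flow for $(G,I,O)$. -/

import Mathlib

/-! Geometries, flows, successor functions, and a step-counting model of the
flow-finding procedure. -/

namespace FlowFinding

/-! ### Geometries and flows

A geometry is a triple `(G, I, O)` with `G` a finite simple graph and `I`, `O` sets of vertices.
A partial function `V ⇀ V` is a function `V → Option V`; the value `none` plays the role of nil. -/

/-- The partial function `f` is a function from the complement of `O` to the complement of `I`:
its domain is exactly the complement of `O` and its values avoid `I`. -/
structure IsMapCompl {V : Type} (I O : Finset V) (f : V → Option V) : Prop where
  dom : ∀ v, f v = none ↔ v ∈ O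
  cod : ∀ v w, f v = some w → w ∉ I

/-- `(f, r)` is a flow for `(G, I, O)`: `f` is a function from the complement of `O` to the
complement of `I`, `r` is a partial order on the vertices, and `v ∼ f v`, `v ≤ f v`, and
`w ∼ f v` implies `v ≤ w`. -/
structure IsFlow {V : Type} (G : SimpleGraph V) (I O : Finset V)
    (f : V → Option V) (r : V → V → Prop) : Prop where
  map : IsMapCompl I O f
  refl : ∀ v, r v v
  trans : ∀ u v w, r u v → r v w → r u w
  antisymm : ∀ v w, r v w → r w v → v = w
  adj : ∀ v u, f v = some u → G.Adj v u
  le_succ : ∀ v u, f v = some u → r v u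
  le_nbr : ∀ v u w, f v = some u → G.Adj w u → r v w

/-- The geometry `(G, I, O)` has a flow. -/
def HasFlow {V : Type} (G : SimpleGraph V) (I O : Finset V) : Prop :=
  ∃ (f : V → Option V) (r : V → V → Prop), IsFlow G I O f r

/-- A collection of (possibly trivial) directed paths of `G`, written as lists of vertices, is a
path cover of `(G, I, O)`: every vertex lies on exactly one path, a path meets `I` at most in its
initial point, and it meets `O` in its final point and nowhere else. -/
structure IsPathCover {V : Type} (G : SimpleGraph V) (I O : Finset V)
    (P : Set (List V)) : Prop where
  path : ∀ l ∈ P, l ≠ [] ∧ l.IsChain G.Adj ∧ l.Nodup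
  cover : ∀ v, ∃! l, l ∈ P ∧ v ∈ l
  input : ∀ l ∈ P, ∀ v ∈ l, v ∈ I → l.head? = some v
  output : ∀ l ∈ P, ∀ v ∈ l, (v ∈ O ↔ l.getLast? = some v)

/-- The maximal orbits of a partial function that are finite sequences: they start outside the
image of `f`, follow `f`, and end outside its domain. (A cyclic orbit is not of this form; its
vertices are then on no path, so that these sequences do not form a path cover.) -/
def maximalOrbits {V : Type} (f : V → Option V) : Set (List V) :=
  {l | l ≠ [] ∧ l.IsChain (fun a b => f a = some b) ∧
    (∀ v, l.head? = some v → ∀ u, f u ≠ some v) ∧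
    (∀ v, l.getLast? = some v → f v = none)}

/-- `f` is a successor function for `(G, I, O)`: an injective function from the complement of `O`
to the complement of `I` whose maximal orbits form a path cover. -/
structure IsSuccessorFunction {V : Type} (G : SimpleGraph V) (I O : Finset V)
    (f : V → Option V) : Prop where
  map : IsMapCompl I O f
  inj : ∀ u v w, f u = some w → f v = some w → u = v
  orbits : IsPathCover G I O (maximalOrbits f)

/-- The influence relation of `f`: `v ≠ w`, and `w = f v` or `w ∼ f v`. -/
def Influences {V : Type} (G : SimpleGraph V) (f : V → Option V) (v w : V) : Prop :=
  v ≠ w ∧ ∃ u, f v = some u ∧ (w = u ∨ G.Adj w u)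

/-- The natural pre-order of `f`: the reflexive and transitive closure of the influence
relation. -/
def NaturalPreorder {V : Type} (G : SimpleGraph V) (f : V → Option V) : V → V → Prop :=
  Relation.ReflTransGen (Influences G f)

/-- `g` is the inverse of `f`, as partial functions. -/
def IsInverse {V : Type} (f g : V → Option V) : Prop :=
  ∀ v w, f v = some w ↔ g w = some v

/-- A triple of arrays `(Dist, Path, Inf)`. -/
structure Infima (V : Type) where
  dist : V → ℕ
  path : V → ℕ
  inf : V → ℕ → ℤ

/-- The triple is a system of infima for the relation `r`. -/
def Infima.IsSystemFor {V : Type} (T : Infima V) (r : V → V → Prop) : Prop :=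
  ∀ v w, r v w ↔ (T.dist v : ℤ) ≤ T.inf w (T.path v)

/-! ### The machine

Unit-cost model. The memory holds arrays indexed by vertices and a few global variables, together
with the number `steps` of elementary steps performed so far. A procedure is a state transformer;
the value `none` stands for a computation that was abandoned before it terminated. Procedures are
written only in terms of the primitives below, each of which costs one step: reading or writing an
array entry or a global variable, evaluating a test, and a bare step (charged for a procedure call,
an iteration of a loop, or an elementary operation on local values). Whole arrays are returned by
reference, in one step. -/

inductive Status where
  | untouched
  | incomplete
  | complete
  deriving DecidableEq

structure Memory (V : Type) where
  f : V → Option V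
  g : V → Option V
  marked : V → ℕ
  iter : ℕ
  foundPath : Bool
  dist : V → ℕ
  path : V → ℕ
  inf : V → ℕ → ℤ
  status : V → Status
  foundCircuit : Bool
  nextPath : ℕ
  steps : ℕ

abbrev Proc (V : Type) (α : Type) : Type := StateT (Memory V) Option α

/-- Read from memory, in one step. -/
def load {V α : Type} (r : Memory V → α) : Proc V α :=
  fun s => some (r s, { s with steps := s.steps + 1 })

/-- Write to memory, in one step. -/
def store {V : Type} (h : Memory V → Memory V) : Proc V Unit :=
  fun s => some ((), { h s with steps := s.steps + 1 })

/-- One step that changes nothing else. -/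
def step {V : Type} : Proc V Unit := store id

/-- Give up. -/
def abandon {V α : Type} : Proc V α := fun _ => none

/-- Evaluate a test, in one step. -/
def test {V : Type} (p : Prop) [Decidable p] : Proc V Bool := load fun _ => decide p

section Primitives

variable {V : Type}

def getF (v : V) : Proc V (Option V) := load fun s => s.f v
def getG (v : V) : Proc V (Option V) := load fun s => s.g v
def getMarked (v : V) : Proc V ℕ := load fun s => s.marked v
def getIter : Proc V ℕ := load fun s => s.iter
def getFoundPath : Proc V Bool := load fun s => s.foundPath
def getDist (v : V) : Proc V ℕ := load fun s => s.dist v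
def getInf (v : V) (p : ℕ) : Proc V ℤ := load fun s => s.inf v p
def getStatus (v : V) : Proc V Status := load fun s => s.status v
def getFoundCircuit : Proc V Bool := load fun s => s.foundCircuit
def getNextPath : Proc V ℕ := load fun s => s.nextPath

def setIter (i : ℕ) : Proc V Unit := store fun s => { s with iter := i }
def setFoundPath (b : Bool) : Proc V Unit := store fun s => { s with foundPath := b }
def setFoundCircuit (b : Bool) : Proc V Unit := store fun s => { s with foundCircuit := b }
def setNextPath (i : ℕ) : Proc V Unit := store fun s => { s with nextPath := i }

variable [DecidableEq V]

def setF (v : V) (x : Option V) : Proc V Unit :=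
  store fun s => { s with f := Function.update s.f v x }
def setG (v : V) (x : Option V) : Proc V Unit :=
  store fun s => { s with g := Function.update s.g v x }
def setMarked (v : V) (i : ℕ) : Proc V Unit :=
  store fun s => { s with marked := Function.update s.marked v i }
def setDist (v : V) (d : ℕ) : Proc V Unit :=
  store fun s => { s with dist := Function.update s.dist v d }
def setPath (v : V) (p : ℕ) : Proc V Unit :=
  store fun s => { s with path := Function.update s.path v p }
def setInf (v : V) (p : ℕ) (z : ℤ) : Proc V Unit :=
  store fun s => { s with inf := Function.update s.inf v (Function.update (s.inf v) p z) }
def setStatus (v : V) (x : Status) : Proc V Unit :=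
  store fun s => { s with status := Function.update s.status v x }

end Primitives

/-- Run `body` on the entries of a list in turn; one step per iteration and one to leave the
loop. -/
def forEach {V α : Type} (body : α → Proc V Unit) : List α → Proc V Unit
  | [] => step
  | a :: l => do
    step
    body a
    forEach body l

/-- A geometry as it is given to the procedures: a list of the vertices, the adjacency list of
every vertex together with its length, membership tables for `I` and `O`, and a list of the
elements of `O`. All lists may be in any order. -/
structure Input {V : Type} (G : SimpleGraph V) (I O : Finset V) where
  verts : List V
  verts_nodup : verts.Nodup
  mem_verts : ∀ v, v ∈ verts
  nbrs : V → List V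
  nbrs_nodup : ∀ v, (nbrs v).Nodup
  mem_nbrs : ∀ v w, w ∈ nbrs v ↔ G.Adj v w
  deg : V → ℕ
  deg_eq : ∀ v, deg v = (nbrs v).length
  isIn : V → Bool
  isIn_iff : ∀ v, isIn v = true ↔ v ∈ I
  isOut : V → Bool
  isOut_iff : ∀ v, isOut v = true ↔ v ∈ O
  outs : List V
  outs_nodup : outs.Nodup
  mem_outs : ∀ v, v ∈ outs ↔ v ∈ O

section Procedures

variable {V : Type} [DecidableEq V] {G : SimpleGraph V} {I O : Finset V}

/-! ### A maximum-size family of vertex-disjoint paths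

The first argument `d` of a procedure bounds the depth of its recursive calls, and the number of
rounds of its unbounded loop; a computation that exceeds the bound is abandoned. -/

/-- The loop of `alternPathSearch` over the neighbours of `v`; `search` is the recursive call. -/
def searchLoop (search : V → Proc V Unit) (D : Input G I O) (v : V) : List V → Proc V Unit
  | [] => step
  | w :: rest => do
    step
    if ← test (D.isOut w = false ∧ (← getMarked w) < (← getIter)) then
      match ← getF w with
      | none =>
        search w
        if ← getFoundPath then
          setF w (some v)
          setG v (some w)
        else
          searchLoop search D v rest
      | some y =>
        if ← test ((← getMarked y) < (← getIter)) then
          search y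
          if ← getFoundPath then
            setF w (some v)
            setG v (some w)
          else
            searchLoop search D v rest
        else
          searchLoop search D v rest
    else
      searchLoop search D v rest

/-- Depth-first search from `v` for an alternating walk, traversed in reverse. -/
def alternPathSearch (D : Input G I O) : ℕ → V → Proc V Unit
  | 0, _ => abandon
  | d + 1, v => do
    step
    setMarked v (← getIter)
    if ← test (D.isIn v = true) then
      setFoundPath true
    else
      match ← getF v with
      | none => searchLoop (alternPathSearch D d) D v (D.nbrs v)
      | some w =>
        if ← test ((← getMarked w) < (← getIter)) then
          alternPathSearch D d w
          if ← getFoundPath then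
            setF v none
            setG v none
          else
            searchLoop (alternPathSearch D d) D v (D.nbrs v)
        else
          searchLoop (alternPathSearch D d) D v (D.nbrs v)

/-- Search from the uncovered elements of `O` in turn, until a search succeeds. -/
def iterSearchLoop (D : Input G I O) (d : ℕ) : List V → Proc V Unit
  | [] => step
  | v :: rest => do
    step
    if ← test (D.isIn v = false ∧ (← getG v) = none) then
      alternPathSearch D d v
      if ← getFoundPath then
        pure ()
      else
        iterSearchLoop D d rest
    else
      iterSearchLoop D d rest

/-- Augment the family of paths until a round of searches fails, within `r` rounds. -/
def buildPathsLoop (D : Input G I O) (d : ℕ) : ℕ → Proc V Unit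
  | 0 => abandon
  | r + 1 => do
    step
    setIter ((← getIter) + 1)
    setFoundPath false
    iterSearchLoop D d D.outs
    if ← getFoundPath then
      buildPathsLoop D d r
    else
      pure ()

/-- Leaves in the arrays `f` and `g` the successor and predecessor functions of a maximum-size
family of vertex-disjoint paths from `I` to `O`. -/
def obtainMaxFamilyPaths (D : Input G I O) (d : ℕ) : Proc V Unit := do
  step
  setIter 0
  forEach (fun v => do
    setMarked v 0
    setF v none
    setG v none) D.verts
  buildPathsLoop D d d

/-! ### The natural pre-order of a successor function -/

/-- `Inf(w, p) ← max (Inf(w, p), Inf(v, p))` for all `p` from `1` to `k`. -/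
def augmentInf (k : ℕ) (w v : V) : Proc V Unit :=
  forEach (fun p => do
    let a ← getInf v p
    if ← test ((← getInf w p) < a) then
      setInf w p a
    else
      pure ()) (List.range' 1 k)

/-- The loop of `findInfima` over the neighbours of `w`, with what follows it; `find` is the
recursive call. -/
def predLoop (find : V → Proc V Unit) (k : ℕ) (w : V) : List V → Proc V Unit
  | [] => do
    step
    setStatus w .complete
  | z :: rest => do
    step
    if ← test ((← getF w) = some z) then
      predLoop find k w rest
    else if ← test ((← getG w) = some z) then
      find z
      if ← getFoundCircuit then
        pure ()
      else
        augmentInf k w z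
        predLoop find k w rest
    else
      match ← getG z with
      | none => predLoop find k w rest
      | some v =>
        find v
        if ← getFoundCircuit then
          pure ()
        else
          augmentInf k w v
          predLoop find k w rest

/-- Computes the infima of `w` in all paths, after those of the vertices that influence `w`. -/
def findInfima (D : Input G I O) (k : ℕ) : ℕ → V → Proc V Unit
  | 0, _ => abandon
  | d + 1, w => do
    step
    match ← getStatus w with
    | .incomplete => setFoundCircuit true
    | .complete => pure ()
    | .untouched =>
      setStatus w .incomplete
      predLoop (findInfima D k d) k w (D.nbrs w)

/-- Assigns the label `P` to `w` and initializes its entries of `Inf` and `status`. -/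
def initializeVertex (k : ℕ) (w : V) (P : ℕ) : Proc V Unit := do
  setPath w P
  forEach (fun p => do
    if ← test (p = P) then
      setInf w p (← getDist w)
    else
      setInf w p (-1)) (List.range' 1 k)
  setStatus w .untouched

/-- Initializes `w` and all vertices that precede it on its path, whose label is `P`. -/
def initializePath (k : ℕ) (P : ℕ) : ℕ → V → Proc V Unit
  | 0, _ => abandon
  | d + 1, w => do
    step
    match ← getG w with
    | none =>
      setDist w 0
      initializeVertex k w P
    | some u =>
      initializePath k P d u
      setDist w ((← getDist u) + 1)
      initializeVertex k w P

/-- Calls `findInfima` for the elements of `O` in turn; returns whether no circuit was found. -/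
def findInfimaLoop (D : Input G I O) (k d : ℕ) : List V → Proc V Bool
  | [] => do
    step
    return true
  | w :: rest => do
    step
    findInfima D k d w
    if ← getFoundCircuit then
      return false
    else
      findInfimaLoop D k d rest

/-- Returns nil, or a system of infima for the natural pre-order of the function in the array
`f`. -/
def testNaturalPreorder (D : Input G I O) (k d : ℕ) : Proc V (Option (Infima V)) := do
  step
  setNextPath 1
  forEach (fun w => do
    initializePath k (← getNextPath) d w
    setNextPath ((← getNextPath) + 1)) D.outs
  setFoundCircuit false
  if ← findInfimaLoop D k d D.outs then
    let T ← load fun s => Infima.mk s.dist s.path s.inf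
    return some T
  else
    return none

/-! ### The complete procedure -/

/-- Number of entries of a list, at one step per entry. -/
def count {α : Type} : List α → Proc V ℕ
  | [] => do
    step
    return 0
  | _ :: l => do
    step
    return (← count l) + 1

/-- Sum of the degrees of the listed vertices, at one step per vertex. -/
def sumDeg (D : Input G I O) : List V → Proc V ℕ
  | [] => do
    step
    return 0
  | v :: l => do
    step
    return (← sumDeg D l) + D.deg v

/-- Is every listed vertex in `I ∩ O`, in the domain of `f`, or in the domain of `g`? -/
def testPathCoverLoop (D : Input G I O) : List V → Proc V Bool
  | [] => do
    step
    return true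
  | v :: rest => do
    step
    if ← test (¬ (D.isIn v = true ∧ D.isOut v = true) ∧
        (← getF v) = none ∧ (← getG v) = none) then
      return false
    else
      testPathCoverLoop D rest

/-- The flow-finding procedure: returns nil, or a triple `(f, g, (Dist, Path, Inf))`. -/
def findFlow (D : Input G I O) (d : ℕ) :
    Proc V (Option ((V → Option V) × (V → Option V) × Infima V)) := do
  step
  let n ← count D.verts
  let m := (← sumDeg D D.verts) / 2
  let k ← count D.outs
  if ← test ((m : ℤ) > (k : ℤ) * n - ((k + 1).choose 2 : ℕ)) then
    return none
  else
    obtainMaxFamilyPaths D d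
    if ← testPathCoverLoop D D.verts then
      match ← testNaturalPreorder D k d with
      | none => return none
      | some T =>
        let fg ← load fun s => (s.f, s.g)
        return some (fg.1, fg.2, T)
    else
      return none

end Procedures

/-- The procedure `p`, run from the memory `s` without any bound on recursion, terminates and
returns `a`, leaving the memory `s'`: all sufficiently large bounds `d` give this outcome. -/
def Returns {V α : Type} (p : ℕ → Proc V α) (s : Memory V) (a : α) (s' : Memory V) : Prop :=
  ∃ N, ∀ d, N ≤ d → (p d).run s = some (a, s')

end FlowFinding

/-!
# Correctness and running time of the flow-finding procedure

*Paths.* A family of vertex-disjoint paths which end in `O` is a matching of vertices outside of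
`O` with vertices: `w` is matched with its successor, or with itself if it is uncovered
(`partner`). The search for an augmentation is the depth-first search for an alternating path in
the corresponding bipartite graph. A successful search augments the matching (`Augments`). It also
creates no cycle of `f`: whenever the search leaves a vertex by an edge outside of the family, the
set of marked vertices is closed under `f`, and the arc which it will create leads into this set
from outside (`Acyclic.update_some`). If all searches of a round fail, the set of marked vertices is
closed under the search (`SearchClosed`).

*Flows.* If a flow exists and `|I| = |O|`, descending along its order shows that no search from an
uncovered element of `O` fails (`IsFlow.not_searchClosed`), and ascending along its order shows
that the flow is the only family which covers `O` (`IsFlow.eq_of_covered`). So the procedure has to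
test only whether the natural pre-order of the function found is antisymmetric.

*Infima.* The calls of the search for infima go along influences of which the natural pre-order is
the reflexive and transitive closure (`IsFamily.naturalPreorder_eq`). A call for an incomplete
vertex exhibits a cycle of calls. A vertex becomes complete only after all vertices it calls for, so
that, if no circuit is found, the relation of calls is well-founded. The entries of `Inf` at `w` are
the maxima of the entries at the vertices that `w` calls for and of those for the path of `w`, which
is what the pre-order requires (`Sound`).

*Time.* The number of steps performed, plus a multiple of the number of edges at the vertices not
visited yet, does not grow in a search (`searchPotential`, `infimaPotential`). There are at most
`k + 1` rounds of searches, and an update of `Inf` takes `O(k)` steps, so that `O(k * (m + n + k))`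
steps suffice. The test of the number `m` of edges ensures that `m ≤ k * n`; it rejects no geometry
with a flow (`IsFlow.card_adj_le`).

The bound on recursion is dealt with once and for all by `Runs.returns_findFlow`: the outcome of a
run that is not abandoned does not depend on the bound.
-/

namespace FlowFinding

/-! ### Reasoning about runs of procedures -/

section Runs

variable {V α β : Type}

/-- Total correctness: started in the memory `s`, the procedure `p` is not abandoned, and its
result and final memory satisfy `Q`. -/
def Runs (p : Proc V α) (s : Memory V) (Q : α → Memory V → Prop) : Prop :=
  ∃ a s', p s = some (a, s') ∧ Q a s'

theorem Runs.mono {p : Proc V α} {s : Memory V} {Q R : α → Memory V → Prop} (h : Runs p s Q)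
    (hQR : ∀ a s', Q a s' → R a s') : Runs p s R := by
  obtain ⟨a, s', h₁, h₂⟩ := h
  exact ⟨a, s', h₁, hQR _ _ h₂⟩

theorem runs_pure {a : α} {s : Memory V} {Q : α → Memory V → Prop} :
    Runs (pure a) s Q ↔ Q a s := by
  constructor
  · rintro ⟨b, s', h, hQ⟩
    cases h
    exact hQ
  · exact fun h => ⟨a, s, rfl, h⟩

theorem runs_bind {p : Proc V α} {q : α → Proc V β} {s : Memory V} {Q : β → Memory V → Prop} :
    Runs (p >>= q) s Q ↔ Runs p s fun a s' => Runs (q a) s' Q := by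
  constructor
  · rintro ⟨b, s', h, hQ⟩
    cases hp : p s with
    | none => simp [bind, StateT.bind, hp] at h
    | some r => exact ⟨r.1, r.2, hp, b, s', by simpa [bind, StateT.bind, hp] using h, hQ⟩
  · rintro ⟨a, s', h, b, s'', h', hQ⟩
    exact ⟨b, s'', by simp [bind, StateT.bind, h, h'], hQ⟩

theorem runs_load {r : Memory V → α} {s : Memory V} {Q : α → Memory V → Prop} :
    Runs (load r) s Q ↔ Q (r s) { s with steps := s.steps + 1 } := by
  constructor
  · rintro ⟨b, s', h, hQ⟩
    cases h
    exact hQ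
  · exact fun h => ⟨_, _, rfl, h⟩

theorem runs_store {h : Memory V → Memory V} {s : Memory V} {Q : Unit → Memory V → Prop} :
    Runs (store h) s Q ↔ Q () { h s with steps := s.steps + 1 } := by
  constructor
  · rintro ⟨b, s', h, hQ⟩
    cases h
    exact hQ
  · exact fun h => ⟨_, _, rfl, h⟩

theorem runs_step {s : Memory V} {Q : Unit → Memory V → Prop} :
    Runs step s Q ↔ Q () { s with steps := s.steps + 1 } :=
  runs_store

theorem runs_test {p : Prop} [Decidable p] {s : Memory V} {Q : Bool → Memory V → Prop} :
    Runs (test p) s Q ↔ Q (decide p) { s with steps := s.steps + 1 } :=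
  runs_load

theorem runs_ite {c : Prop} [Decidable c] {p q : Proc V α} {s : Memory V}
    {Q : α → Memory V → Prop} :
    Runs (if c then p else q) s Q ↔ if c then Runs p s Q else Runs q s Q := by
  split_ifs <;> rfl

end Runs

/-! ### Independence of the bound on recursion -/

section Extends

variable {V α β : Type}

/-- The procedure `q` has the same outcome as `p` wherever `p` is not abandoned. -/
def Extends (p q : Proc V α) : Prop := ∀ s r, p s = some r → q s = some r

theorem Extends.refl (p : Proc V α) : Extends p p := fun _ _ h => h

theorem extends_abandon (p : Proc V α) : Extends abandon p := fun _ _ h => by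
  simp [abandon] at h

theorem Extends.bind {p p' : Proc V α} {q q' : α → Proc V β} (hp : Extends p p')
    (hq : ∀ a, Extends (q a) (q' a)) : Extends (p >>= q) (p' >>= q') := by
  intro s r h
  cases hps : p s with
  | none => simp [Bind.bind, StateT.bind, hps] at h
  | some t =>
    have h₂ : q t.1 t.2 = some r := by simpa [Bind.bind, StateT.bind, hps] using h
    simp [Bind.bind, StateT.bind, hp s t hps, hq _ _ _ h₂]

theorem Extends.bind_right {p : Proc V α} {q q' : α → Proc V β}
    (hq : ∀ a, Extends (q a) (q' a)) : Extends (p >>= q) (p >>= q') :=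
  (Extends.refl p).bind hq

theorem Extends.ite {c : Prop} [Decidable c] {p p' q q' : Proc V α} (hp : Extends p p')
    (hq : Extends q q') : Extends (if c then p else q) (if c then p' else q') := by
  split_ifs <;> assumption

theorem Extends.forEach {b b' : α → Proc V Unit} (h : ∀ a, Extends (b a) (b' a)) (l : List α) :
    Extends (forEach b l) (forEach b' l) := by
  induction l with
  | nil => exact .refl _
  | cons a l ih => exact .bind_right fun _ => .bind (h a) fun _ => ih

variable [DecidableEq V] {G : SimpleGraph V} {I O : Finset V} (D : Input G I O)

theorem Extends.searchLoop {p q : V → Proc V Unit} (h : ∀ w, Extends (p w) (q w)) (v : V)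
    (l : List V) : Extends (searchLoop p D v l) (searchLoop q D v l) := by
  induction l with
  | nil => exact .refl _
  | cons w l ih =>
    refine .bind_right fun _ => .bind_right fun _ => .bind_right fun _ => .bind_right fun _ =>
      .ite (.bind_right fun x => ?_) ih
    cases x with
    | none => exact .bind (h w) fun _ => .bind_right fun _ => .ite (.refl _) ih
    | some y =>
      exact .bind_right fun _ => .bind_right fun _ => .bind_right fun _ => .ite
        (.bind (h y) fun _ => .bind_right fun _ => .ite (.refl _) ih) ih

theorem extends_alternPathSearch_succ (d : ℕ) (v : V) :
    Extends (alternPathSearch D d v) (alternPathSearch D (d + 1) v) := by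
  induction d generalizing v with
  | zero => exact extends_abandon _
  | succ d ih =>
    have hl := Extends.searchLoop D ih v (D.nbrs v)
    refine .bind_right fun _ => .bind_right fun _ => .bind_right fun _ => .bind_right fun _ =>
      .ite (.refl _) (.bind_right fun x => ?_)
    cases x with
    | none => exact hl
    | some w =>
      exact .bind_right fun _ => .bind_right fun _ => .bind_right fun _ =>
        .ite (.bind (ih w) fun _ => .bind_right fun _ => .ite (.refl _) hl) hl

theorem Extends.iterSearchLoop (d : ℕ) (l : List V) :
    Extends (iterSearchLoop D d l) (iterSearchLoop D (d + 1) l) := by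
  induction l with
  | nil => exact .refl _
  | cons v l ih =>
    exact .bind_right fun _ => .bind_right fun _ => .bind_right fun _ => .ite
      (.bind (extends_alternPathSearch_succ D d v) fun _ => .bind_right fun _ =>
        .ite (.refl _) ih) ih

theorem Extends.buildPathsLoop (d r : ℕ) :
    Extends (buildPathsLoop D d r) (buildPathsLoop D (d + 1) (r + 1)) := by
  induction r with
  | zero => exact extends_abandon _
  | succ r ih =>
    exact .bind_right fun _ => .bind_right fun _ => .bind_right fun _ => .bind_right fun _ =>
      .bind (.iterSearchLoop D d _) fun _ => .bind_right fun _ => .ite ih (.refl _)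

theorem Extends.predLoop {p q : V → Proc V Unit} (h : ∀ w, Extends (p w) (q w)) (k : ℕ) (w : V)
    (l : List V) : Extends (predLoop p k w l) (predLoop q k w l) := by
  induction l with
  | nil => exact .refl _
  | cons z l ih =>
    refine .bind_right fun _ => .bind_right fun _ => .bind_right fun _ => .ite ih
      (.bind_right fun _ => .bind_right fun _ => .ite
        (.bind (h z) fun _ => .bind_right fun _ => .ite (.refl _) (.bind_right fun _ => ih))
        (.bind_right fun x => ?_))
    cases x with
    | none => exact ih
    | some v =>
      exact .bind (h v) fun _ => .bind_right fun _ => .ite (.refl _) (.bind_right fun _ => ih)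

theorem extends_findInfima_succ (k d : ℕ) (w : V) :
    Extends (findInfima D k d w) (findInfima D k (d + 1) w) := by
  induction d generalizing w with
  | zero => exact extends_abandon _
  | succ d ih =>
    refine .bind_right fun _ => .bind_right fun x => ?_
    cases x with
    | untouched => exact .bind_right fun _ => .predLoop ih k w _
    | incomplete => exact .refl _
    | complete => exact .refl _

theorem extends_initializePath_succ (k P d : ℕ) (w : V) :
    Extends (initializePath k P d w) (initializePath k P (d + 1) w) := by
  induction d generalizing w with
  | zero => exact extends_abandon _
  | succ d ih =>
    refine .bind_right fun _ => .bind_right fun x => ?_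
    cases x with
    | none => exact .refl _
    | some u => exact .bind (ih u) fun _ => .refl _

theorem Extends.findInfimaLoop (k d : ℕ) (l : List V) :
    Extends (findInfimaLoop D k d l) (findInfimaLoop D k (d + 1) l) := by
  induction l with
  | nil => exact .refl _
  | cons w l ih =>
    exact .bind_right fun _ => .bind (extends_findInfima_succ D k d w) fun _ =>
      .bind_right fun _ => .ite (.refl _) ih

theorem extends_findFlow_succ (d : ℕ) : Extends (findFlow D d) (findFlow D (d + 1)) := by
  refine .bind_right fun _ => .bind_right fun _ => .bind_right fun _ => .bind_right fun k =>
    .bind_right fun _ => .ite (.refl _) (.bind ?_ fun _ => .bind_right fun _ => .ite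
      (.bind ?_ fun _ => .refl _) (.refl _))
  · exact .bind_right fun _ => .bind_right fun _ => .bind_right fun _ => .buildPathsLoop D d d
  · refine .bind_right fun _ => .bind_right fun _ => .bind (.forEach (fun w => ?_) _) fun _ =>
      .bind_right fun _ => .bind (.findInfimaLoop D k d _) fun _ => .refl _
    exact .bind_right fun P => .bind (extends_initializePath_succ k P d w) fun _ => .refl _

/-- A run of the procedure with one sufficient bound on recursion decides its outcome. -/
theorem Runs.returns_findFlow {d : ℕ} {s : Memory V}
    {Q : Option ((V → Option V) × (V → Option V) × Infima V) → Memory V → Prop}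
    (h : Runs (findFlow D d) s Q) :
    ∃ a s', Returns (findFlow D) s a s' ∧ Q a s' := by
  obtain ⟨a, s', hr, hQ⟩ := h
  refine ⟨a, s', ⟨d, fun e he => ?_⟩, hQ⟩
  induction e, he using Nat.le_induction with
  | base => exact hr
  | succ e _ ih => exact extends_findFlow_succ D e s _ ih

end Extends

/-! ### Acyclic partial functions -/

section Acyclic

variable {V : Type}

/-- Every forward orbit of the partial function `f` is finite. -/
def Acyclic (f : V → Option V) : Prop := WellFounded fun b a => f a = some b

theorem Acyclic.irrefl {f : V → Option V} (h : Acyclic f) {v : V}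
    (hv : Relation.TransGen (fun a b => f a = some b) v v) : False := by
  have h' := WellFounded.transGen h
  have : Relation.TransGen (fun b a => f a = some b) v v := by
    rw [← Relation.transGen_swap]
    exact hv
  exact h'.irrefl.irrefl v this

theorem Acyclic.wellFounded_pred [Finite V] {f : V → Option V} (h : Acyclic f) :
    WellFounded fun a b => f a = some b := by
  have : Std.Irrefl (Relation.TransGen fun a b => f a = some b) := ⟨fun _ hv => h.irrefl hv⟩
  exact Subrelation.wf (r := Relation.TransGen fun a b => f a = some b)
    (fun {_ _} hab => Relation.TransGen.single hab) (Finite.wellFounded_of_trans_of_irrefl _)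

variable [DecidableEq V]

theorem Acyclic.update_none {f : V → Option V} (h : Acyclic f) (v : V) :
    Acyclic (Function.update f v none) := by
  refine Subrelation.wf (fun {b a} hab => ?_) h
  by_cases hav : a = v
  · subst hav
    simp at hab
  · simpa [Function.update_of_ne hav] using hab

/-- Redirecting an arc from outside of a closed set into that set creates no cycle. -/
theorem Acyclic.update_some {f : V → Option V} (h : Acyclic f) {T : V → Prop}
    (hT : ∀ x y, T x → f x = some y → T y) {v w : V} (hv : T v) (hw : ¬ T w) :
    Acyclic (Function.update f w (some v)) := by
  have hin : ∀ x, T x → Acc (fun b a => Function.update f w (some v) a = some b) x := by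
    intro x
    induction x using h.induction with
    | _ x ih =>
      refine fun hx => ⟨_, fun y hy => ?_⟩
      have hxw : x ≠ w := fun e => hw (e ▸ hx)
      simp only [Function.update_of_ne hxw] at hy
      exact ih y hy (hT x y hx hy)
  refine ⟨fun x => ?_⟩
  induction x using h.induction with
  | _ x ih =>
    refine ⟨_, fun y hy => ?_⟩
    by_cases hxw : x = w
    · subst hxw
      simp only [Function.update_self, Option.some.injEq] at hy
      exact hin y (hy ▸ hv)
    · simp only [Function.update_of_ne hxw] at hy
      exact ih y hy

end Acyclic

/-! ### Families of disjoint paths and their augmentation -/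

section Augment

variable {V : Type} {G : SimpleGraph V} {I O : Finset V}

/-- The arrays `f` and `g` are the successor and predecessor functions of a family of
vertex-disjoint paths of `G` which start in `I`, or at an element of `O` that is yet to be joined
to `I`, and which end in `O`. -/
structure IsFamily (G : SimpleGraph V) (I O : Finset V) (f g : V → Option V) : Prop where
  acyclic : Acyclic f
  notMem_out : ∀ w y, f w = some y → w ∉ O
  notMem_in : ∀ w y, f w = some y → y ∉ I
  adj : ∀ w y, f w = some y → G.Adj w y
  inverse : IsInverse f g
  free : ∀ x, x ∉ I → x ∉ O → (f x = none ↔ g x = none)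

theorem IsFamily.inj {f g : V → Option V} (h : IsFamily G I O f g) {u v w : V}
    (hu : f u = some w) (hv : f v = some w) : u = v := by
  have := (h.inverse u w).1 hu
  rw [(h.inverse v w).1 hv] at this
  exact (Option.some.inj this).symm

/-- The effect of a successful search from `v`, where `T` is the set of vertices that were marked
before. The vertex `v` now has a path from `I` to it, given by the new arrays `f'` and `g'`, which
is yet to be joined to the vertex that was searched from before `v`. Until then the old
predecessor `p` of `v` keeps a stale entry `f' p = v`. -/
structure Augments (G : SimpleGraph V) (I O : Finset V) (T : V → Prop) (v : V)
    (f g f' g' : V → Option V) : Prop where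
  acyclic : Acyclic f'
  notMem_out : ∀ w y, f' w = some y → w ∉ O
  notMem_in : ∀ w y, f' w = some y → y ∉ I
  adj : ∀ w y, f' w = some y → G.Adj w y
  frame_f : ∀ w, T w → f' w = f w
  frame_f' : ∀ w y, T y → f w = some y → f' w = some y
  frame_g : ∀ y, T y → g' y = g y
  of_f : ∀ w y, f' w = some y → g' y = some w ∨ y = v ∧ f w = some v
  of_g : ∀ w y, g' y = some w → f' w = some y
  free : ∀ x, x ∉ I → x ∉ O → x ≠ v → (f' x = none ↔ g' x = none)
  stale : ∀ p, f p = some v → f' p = some v ∧ g' v ≠ some p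
  none_of_none : f v = none → f' v = none
  source_of_none : v ∉ I → v ∉ O → f v = none → g' v ≠ none
  source_of_some : v ∉ I → v ∉ O → f v ≠ none → (f' v = none ↔ g' v = none)
  covered : ∀ y ∈ O, y ≠ v → g y ≠ none → g' y ≠ none
  covered_self : v ∈ O → v ∉ I → g' v ≠ none

variable {T T' : V → Prop} {v w : V} {f g f' g' : V → Option V}

theorem IsFamily.augments_of_mem (h : IsFamily G I O f g) (hv : v ∈ I) :
    Augments G I O T v f g f g where
  acyclic := h.acyclic
  notMem_out := h.notMem_out
  notMem_in := h.notMem_in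
  adj := h.adj
  frame_f _ _ := rfl
  frame_f' _ _ _ h := h
  frame_g _ _ := rfl
  of_f w y hw := .inl ((h.inverse w y).1 hw)
  of_g w y hy := (h.inverse w y).2 hy
  free x hI hO _ := h.free x hI hO
  stale p hp := absurd hv (h.notMem_in p v hp)
  none_of_none h := h
  source_of_none hI := absurd hv hI
  source_of_some hI := absurd hv hI
  covered _ _ _ h := h
  covered_self _ hI := absurd hv hI

/-- A search from an uncovered element of `O` leaves no stale entry. -/
theorem Augments.isFamily (h : IsFamily G I O f g) (hvO : v ∈ O) (hgv : g v = none)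
    (ha : Augments G I O T v f g f' g') : IsFamily G I O f' g' where
  acyclic := ha.acyclic
  notMem_out := ha.notMem_out
  notMem_in := ha.notMem_in
  adj := ha.adj
  inverse w y := by
    refine ⟨fun hw => ?_, ha.of_g w y⟩
    rcases ha.of_f w y hw with hg | ⟨_, hw⟩
    · exact hg
    · rw [(h.inverse w v).1 hw] at hgv
      simp at hgv
  free x hI hO := ha.free x hI hO fun e => hO (e ▸ hvO)

variable [DecidableEq V]

/-- The path to `w = f v` makes `v` superfluous on its own path: `v` becomes uncovered. -/
theorem Augments.discard (h : IsFamily G I O f g) (hvI : v ∉ I) (hvT : ¬ T v) (hfv : f v = some w)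
    (hwT : ¬ T w) (hT : ∀ x, T x → T' x) (hvT' : T' v) (ha : Augments G I O T' w f g f' g') :
    Augments G I O T v f g (Function.update f' v none) (Function.update g' v none) := by
  have hvO : v ∉ O := h.notMem_out v w hfv
  have hwI : w ∉ I := h.notMem_in v w hfv
  have hgw : g w = some v := (h.inverse v w).1 hfv
  have hvw : v ≠ w := (h.adj v w hfv).ne
  have hup : ∀ x y, Function.update f' v none x = some y → x ≠ v ∧ f' x = some y := by
    intro x y hx
    by_cases e : x = v
    · subst e; simp at hx
    · exact ⟨e, by simpa [Function.update_of_ne e] using hx⟩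
  have hst := ha.stale v hfv
  refine
    { acyclic := ha.acyclic.update_none v
      notMem_out := fun x y hx => ha.notMem_out x y (hup x y hx).2
      notMem_in := fun x y hx => ha.notMem_in x y (hup x y hx).2
      adj := fun x y hx => ha.adj x y (hup x y hx).2
      frame_f := fun x hx => ?_
      frame_f' := fun x y hy hx => ?_
      frame_g := fun y hy => ?_
      of_f := fun x y hx => ?_
      of_g := fun x y hy => ?_
      free := fun x hI hO hxv => ?_
      stale := fun p hp => ?_
      none_of_none := fun e => by simp [hfv] at e
      source_of_none := fun _ _ e => by simp [hfv] at e
      source_of_some := fun _ _ _ => by simp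
      covered := fun y hy hyv hg => ?_
      covered_self := fun e => absurd e hvO }
  · rw [Function.update_of_ne (show x ≠ v from fun e => hvT (e ▸ hx))]
    exact ha.frame_f x (hT x hx)
  · have e : x ≠ v := by
      rintro rfl
      rw [hfv] at hx
      exact hwT (Option.some.inj hx ▸ hy)
    rw [Function.update_of_ne e]
    exact ha.frame_f' x y (hT y hy) hx
  · rw [Function.update_of_ne (show y ≠ v from fun e => hvT (e ▸ hy))]
    exact ha.frame_g y (hT y hy)
  · obtain ⟨hxv, hx⟩ := hup x y hx
    rcases ha.of_f x y hx with hg | ⟨rfl, hx'⟩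
    · by_cases e : y = v
      · subst e
        rw [ha.frame_g y hvT'] at hg
        exact .inr ⟨rfl, (h.inverse x y).2 hg⟩
      · exact .inl (by rwa [Function.update_of_ne e])
    · exact absurd (h.inj hx' hfv) hxv
  · by_cases e : y = v
    · subst e; simp at hy
    · rw [Function.update_of_ne e] at hy
      have hx := ha.of_g x y hy
      by_cases e' : x = v
      · subst e'
        rw [hst.1] at hx
        obtain rfl := Option.some.inj hx
        exact absurd hy hst.2
      · rwa [Function.update_of_ne e']
  · rw [Function.update_of_ne hxv, Function.update_of_ne hxv]
    by_cases e : x = w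
    · subst e
      refine ha.source_of_some hI hO fun e => ?_
      rw [(h.free x hI hO).1 e] at hgw
      simp at hgw
    · exact ha.free x hI hO e
  · rw [Function.update_of_ne (h.adj p v hp).ne]
    exact ⟨ha.frame_f' p v hvT' hp, by simp⟩
  · rw [Function.update_of_ne hyv]
    by_cases e : y = w
    · subst e
      exact ha.covered_self hy hwI
    · exact ha.covered y hy e hg

/-- The path to the uncovered vertex `w` is prolonged to its neighbour `v`. -/
theorem Augments.attach_uncovered (h : IsFamily G I O f g) (hvI : v ∉ I) (hvT : ¬ T v)
    (hadj : G.Adj w v) (hwO : w ∉ O) (hfw : f w = none) (hwT : ¬ T' w) (hT : ∀ x, T x → T' x)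
    (hvT' : T' v) (hcl : ∀ x y, T' x → f x = some y → T' y)
    (ha : Augments G I O T' w f g f' g') :
    Augments G I O T v f g (Function.update f' w (some v)) (Function.update g' v (some w)) := by
  have hvw : v ≠ w := hadj.ne'
  have hf'w : f' w = none := ha.none_of_none hfw
  have hup : ∀ x y, Function.update f' w (some v) x = some y →
      x = w ∧ y = v ∨ x ≠ w ∧ f' x = some y := by
    intro x y hx
    by_cases e : x = w
    · subst e; simp at hx; exact .inl ⟨rfl, hx.symm⟩
    · exact .inr ⟨e, by simpa [Function.update_of_ne e] using hx⟩
  have hnw : ∀ x, f x ≠ some w := by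
    intro x hx
    have hg := (h.inverse x w).1 hx
    rw [(h.free w (h.notMem_in x w hx) hwO).1 hfw] at hg
    simp at hg
  refine
    { acyclic := ha.acyclic.update_some (T := T')
        (fun x y hx hy => hcl x y hx (by rwa [← ha.frame_f x hx])) hvT' hwT
      notMem_out := fun x y hx => ?_
      notMem_in := fun x y hx => ?_
      adj := fun x y hx => ?_
      frame_f := fun x hx => ?_
      frame_f' := fun x y hy hx => ?_
      frame_g := fun y hy => ?_
      of_f := fun x y hx => ?_
      of_g := fun x y hy => ?_
      free := fun x hI hO hxv => ?_
      stale := fun p hp => ?_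
      none_of_none := fun e => ?_
      source_of_none := fun _ _ e => by simp
      source_of_some := fun _ _ e => ?_
      covered := fun y hy hyv hg => ?_
      covered_self := fun _ _ => by simp }
  · rcases hup x y hx with ⟨rfl, rfl⟩ | ⟨_, hx⟩
    exacts [hwO, ha.notMem_out x y hx]
  · rcases hup x y hx with ⟨rfl, rfl⟩ | ⟨_, hx⟩
    exacts [hvI, ha.notMem_in x y hx]
  · rcases hup x y hx with ⟨rfl, rfl⟩ | ⟨_, hx⟩
    exacts [hadj, ha.adj x y hx]
  · rw [Function.update_of_ne (show x ≠ w from fun e => hwT (e ▸ hT x hx))]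
    exact ha.frame_f x (hT x hx)
  · rw [Function.update_of_ne (by rintro rfl; simp [hfw] at hx)]
    exact ha.frame_f' x y (hT y hy) hx
  · rw [Function.update_of_ne (show y ≠ v from fun e => hvT (e ▸ hy))]
    exact ha.frame_g y (hT y hy)
  · rcases hup x y hx with ⟨rfl, rfl⟩ | ⟨hxw, hx⟩
    · exact .inl (by simp)
    · rcases ha.of_f x y hx with hg | ⟨rfl, hx'⟩
      · by_cases e : y = v
        · subst e
          rw [ha.frame_g y hvT'] at hg
          exact .inr ⟨rfl, (h.inverse x y).2 hg⟩
        · exact .inl (by rwa [Function.update_of_ne e])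
      · exact absurd hx' (hnw x)
  · by_cases e : y = v
    · subst e
      simp only [Function.update_self, Option.some.injEq] at hy
      simp [← hy]
    · rw [Function.update_of_ne e] at hy
      have hx := ha.of_g x y hy
      rw [Function.update_of_ne (by rintro rfl; simp [hf'w] at hx)]
      exact hx
  · rw [Function.update_of_ne hxv]
    by_cases e : x = w
    · subst e
      simpa using ha.source_of_none hI hO hfw
    · rw [Function.update_of_ne e]
      exact ha.free x hI hO e
  · have hpw : p ≠ w := by rintro rfl; simp [hfw] at hp
    rw [Function.update_of_ne hpw]
    exact ⟨ha.frame_f' p v hvT' hp, by simpa using hpw.symm⟩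
  · rw [Function.update_of_ne hvw, ha.frame_f v hvT', e]
  · rw [Function.update_of_ne hvw, ha.frame_f v hvT']
    simpa using e
  · rw [Function.update_of_ne hyv]
    exact ha.covered y hy (by rintro rfl; exact hwO hy) hg

/-- The path to `y₀ = f w` frees its predecessor `w`, whose own path is redirected to the
neighbour `v` of `w`. -/
theorem Augments.attach_covered (h : IsFamily G I O f g) (hvI : v ∉ I) (hvT : ¬ T v)
    (hadj : G.Adj w v) (hwO : w ∉ O) {y₀ : V} (hfw : f w = some y₀) (hwT : ¬ T' w)
    (hyT : ¬ T' y₀) (hT : ∀ x, T x → T' x)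
    (hvT' : T' v) (hcl : ∀ x y, T' x → f x = some y → T' y)
    (ha : Augments G I O T' y₀ f g f' g') :
    Augments G I O T v f g (Function.update f' w (some v)) (Function.update g' v (some w)) := by
  have hvw : v ≠ w := hadj.ne'
  have hvy : v ≠ y₀ := fun e => hyT (e ▸ hvT')
  have hyw : y₀ ≠ w := (h.adj w y₀ hfw).ne'
  have hst := ha.stale w hfw
  have hgy : g y₀ = some w := (h.inverse w y₀).1 hfw
  have hup : ∀ x y, Function.update f' w (some v) x = some y →
      x = w ∧ y = v ∨ x ≠ w ∧ f' x = some y := by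
    intro x y hx
    by_cases e : x = w
    · subst e; simp at hx; exact .inl ⟨rfl, hx.symm⟩
    · exact .inr ⟨e, by simpa [Function.update_of_ne e] using hx⟩
  refine
    { acyclic := ha.acyclic.update_some (T := T')
        (fun x y hx hy => hcl x y hx (by rwa [← ha.frame_f x hx])) hvT' hwT
      notMem_out := fun x y hx => ?_
      notMem_in := fun x y hx => ?_
      adj := fun x y hx => ?_
      frame_f := fun x hx => ?_
      frame_f' := fun x y hy hx => ?_
      frame_g := fun y hy => ?_
      of_f := fun x y hx => ?_
      of_g := fun x y hy => ?_
      free := fun x hI hO hxv => ?_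
      stale := fun p hp => ?_
      none_of_none := fun e => ?_
      source_of_none := fun _ _ e => by simp
      source_of_some := fun _ _ e => ?_
      covered := fun y hy hyv hg => ?_
      covered_self := fun _ _ => by simp }
  · rcases hup x y hx with ⟨rfl, rfl⟩ | ⟨_, hx⟩
    exacts [hwO, ha.notMem_out x y hx]
  · rcases hup x y hx with ⟨rfl, rfl⟩ | ⟨_, hx⟩
    exacts [hvI, ha.notMem_in x y hx]
  · rcases hup x y hx with ⟨rfl, rfl⟩ | ⟨_, hx⟩
    exacts [hadj, ha.adj x y hx]
  · rw [Function.update_of_ne (show x ≠ w from fun e => hwT (e ▸ hT x hx))]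
    exact ha.frame_f x (hT x hx)
  · have e : x ≠ w := by
      rintro rfl
      exact hyT (Option.some.inj (hfw.symm.trans hx) ▸ hT y hy)
    rw [Function.update_of_ne e]
    exact ha.frame_f' x y (hT y hy) hx
  · rw [Function.update_of_ne (show y ≠ v from fun e => hvT (e ▸ hy))]
    exact ha.frame_g y (hT y hy)
  · rcases hup x y hx with ⟨rfl, rfl⟩ | ⟨hxw, hx⟩
    · exact .inl (by simp)
    · rcases ha.of_f x y hx with hg | ⟨rfl, hx'⟩
      · by_cases e : y = v
        · subst e
          rw [ha.frame_g y hvT'] at hg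
          exact .inr ⟨rfl, (h.inverse x y).2 hg⟩
        · exact .inl (by rwa [Function.update_of_ne e])
      · exact absurd (h.inj hx' hfw) hxw
  · by_cases e : y = v
    · subst e
      simp only [Function.update_self, Option.some.injEq] at hy
      simp [← hy]
    · rw [Function.update_of_ne e] at hy
      have hx := ha.of_g x y hy
      rw [Function.update_of_ne, hx]
      rintro rfl
      rw [hst.1] at hx
      obtain rfl := Option.some.inj hx
      exact hst.2 hy
  · rw [Function.update_of_ne hxv]
    by_cases e : x = w
    · subst e
      have := (ha.free x hI hO hyw.symm).not
      rw [hst.1] at this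
      simpa using this
    · rw [Function.update_of_ne e]
      by_cases e' : x = y₀
      · subst e'
        refine ha.source_of_some hI hO fun e => ?_
        rw [(h.free x hI hO).1 e] at hgy
        simp at hgy
      · exact ha.free x hI hO e'
  · have hpw : p ≠ w := by
      rintro rfl
      exact hvy (Option.some.inj (hp.symm.trans hfw))
    rw [Function.update_of_ne hpw]
    exact ⟨ha.frame_f' p v hvT' hp, by simpa using hpw.symm⟩
  · rw [Function.update_of_ne hvw, ha.frame_f v hvT', e]
  · rw [Function.update_of_ne hvw, ha.frame_f v hvT']
    simpa using e
  · rw [Function.update_of_ne hyv]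
    by_cases e : y = y₀
    · subst e
      exact ha.covered_self hy (h.notMem_in w y hfw)
    · exact ha.covered y hy e hg

end Augment

/-! ### Flows are the only maximum families -/

section Flow

variable {V : Type} {G : SimpleGraph V} {I O : Finset V} {F f g : V → Option V}
  {r : V → V → Prop}

theorem IsFlow.inj (h : IsFlow G I O F r) {u v w : V} (hu : F u = some w) (hv : F v = some w) :
    u = v :=
  h.antisymm u v (h.le_nbr u w v hu (h.adj v w hv)) (h.le_nbr v w u hv (h.adj u w hu))

theorem IsMapCompl.exists_eq_some (h : IsMapCompl I O F) {v : V} (hv : v ∉ O) :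
    ∃ w, F v = some w :=
  Option.ne_none_iff_exists'.1 fun e => hv ((h.dom v).1 e)

theorem IsMapCompl.notMem_out (h : IsMapCompl I O F) {v w : V} (hv : F v = some w) : v ∉ O := by
  intro e
  rw [(h.dom v).2 e] at hv
  simp at hv

theorem IsFlow.surj [Fintype V] (h : IsFlow G I O F r) (hc : I.card = O.card)
    {w : V} (hw : w ∉ I) : ∃ u, F u = some w := by
  classical
  have := Finset.surj_on_of_inj_on_of_card_le (s := Oᶜ) (t := Iᶜ)
    (fun v hv => (h.map.exists_eq_some (Finset.mem_compl.1 hv)).choose)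
    (fun v hv => Finset.mem_compl.2
      (h.map.cod v _ (h.map.exists_eq_some (Finset.mem_compl.1 hv)).choose_spec))
    (fun u v hu hv e => by
      have h₁ := (h.map.exists_eq_some (Finset.mem_compl.1 hu)).choose_spec
      have h₂ := (h.map.exists_eq_some (Finset.mem_compl.1 hv)).choose_spec
      exact h.inj (e ▸ h₁) h₂)
    (by rw [Finset.card_compl, Finset.card_compl, hc]) w (Finset.mem_compl.2 hw)
  obtain ⟨u, hu, rfl⟩ := this
  exact ⟨u, (h.map.exists_eq_some (Finset.mem_compl.1 hu)).choose_spec⟩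

theorem IsFlow.wellFounded [Finite V] (h : IsFlow G I O F r) :
    WellFounded fun u v => r u v ∧ u ≠ v := by
  have : IsTrans V fun u v => r u v ∧ u ≠ v :=
    ⟨fun a b c hab hbc => ⟨h.trans _ _ _ hab.1 hbc.1, by
      rintro rfl
      exact hab.2 (h.antisymm _ _ hab.1 hbc.1)⟩⟩
  have : Std.Irrefl fun u v => r u v ∧ u ≠ v := ⟨fun a ha => ha.2 rfl⟩
  exact Finite.wellFounded_of_trans_of_irrefl _

theorem IsFlow.wellFounded_gt [Finite V] (h : IsFlow G I O F r) :
    WellFounded fun v u => r u v ∧ u ≠ v := by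
  have : IsTrans V fun v u => r u v ∧ u ≠ v :=
    ⟨fun a b c hab hbc => ⟨h.trans _ _ _ hbc.1 hab.1, by
      rintro rfl
      exact hab.2 (h.antisymm _ _ hab.1 hbc.1)⟩⟩
  have : Std.Irrefl fun v u => r u v ∧ u ≠ v := ⟨fun a ha => ha.2 rfl⟩
  exact Finite.wellFounded_of_trans_of_irrefl _

/-- A family of disjoint paths as a matching of vertices outside of `O` with vertices: a vertex is
matched with its successor, or with itself if it is uncovered. Augmenting the family amounts to
augmenting this matching. -/
def partner (f : V → Option V) (w : V) : V := (f w).getD w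

theorem partner_of_some {w y : V} (h : f w = some y) : partner f w = y := by simp [partner, h]

theorem partner_of_none {w : V} (h : f w = none) : partner f w = w := by simp [partner, h]

theorem IsFamily.partner_adj (h : IsFamily G I O f g) (w : V) :
    partner f w = w ∨ G.Adj w (partner f w) := by
  cases hw : f w with
  | none => exact .inl (partner_of_none hw)
  | some y => exact .inr (partner_of_some hw ▸ h.adj w y hw)

theorem IsFamily.partner_inj (h : IsFamily G I O f g) {u w : V} (hu : u ∉ O)
    (hw : w ∉ O) (e : partner f u = partner f w) : u = w := by
  have key : ∀ {a b y : V}, a ∉ O → f a = none → f b = some y → a ≠ y := by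
    rintro a b y ha hfa hfb rfl
    have := (h.inverse b a).1 hfb
    rw [(h.free a (h.notMem_in b a hfb) ha).1 hfa] at this
    simp at this
  cases hfu : f u with
  | none =>
    cases hfw : f w with
    | none => rwa [partner_of_none hfu, partner_of_none hfw] at e
    | some y =>
      rw [partner_of_none hfu, partner_of_some hfw] at e
      exact absurd e (key hu hfu hfw)
  | some x =>
    cases hfw : f w with
    | none =>
      rw [partner_of_some hfu, partner_of_none hfw] at e
      exact absurd e.symm (key hw hfw hfu)
    | some y =>
      rw [partner_of_some hfu, partner_of_some hfw] at e
      exact h.inj (e ▸ hfu) hfw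

/-- The set `T` is closed under the search at `x`: the search does not end at `x` and does not
leave `T` from `x`. -/
def SearchClosed (G : SimpleGraph V) (I O : Finset V) (f : V → Option V) (T : V → Prop)
    (x : V) : Prop :=
  x ∉ I ∧ (x ∉ O → T (partner f x)) ∧ ∀ w, G.Adj x w → w ∉ O → T (partner f w)

theorem SearchClosed.mono {f : V → Option V} {T T' : V → Prop} (h : ∀ x, T x → T' x) {x : V}
    (hx : SearchClosed G I O f T x) : SearchClosed G I O f T' x :=
  ⟨hx.1, fun hO => h _ (hx.2.1 hO), fun w hw hO => h _ (hx.2.2 w hw hO)⟩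

/-- If a flow exists, a search from an uncovered element of `O` does not fail. For if the set `T`
of searched vertices were closed, the family would match every vertex which the flow maps into
`T` with its image under the flow: a minimal exception `u` would be matched with the image of a
smaller exception. But then the preimage of the start of the search would precede it. -/
theorem IsFlow.not_searchClosed [Fintype V] (hF : IsFlow G I O F r)
    (hc : I.card = O.card) (h : IsFamily G I O f g) {T : V → Prop}
    (hT : ∀ x, T x → SearchClosed G I O f T x) {v : V} (hv : T v) (hgv : g v = none) : False := by
  have key : ∀ u y, F u = some y → T y → partner f u = y := by
    intro u
    induction u using hF.wellFounded.induction with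
    | _ u ih =>
      intro y hu hy
      have huO := hF.map.notMem_out hu
      have hM : T (partner f u) := (hT y hy).2.2 u (hF.adj u y hu).symm huO
      obtain ⟨u', hu'⟩ := hF.surj hc (hT _ hM).1
      by_cases e : u' = u
      · subst e
        exact Option.some.inj (hu'.symm.trans hu)
      · have hr : r u' u := by
          rcases h.partner_adj u with e' | hadj
          · exact hF.le_succ u' u (e' ▸ hu')
          · exact hF.le_nbr u' _ u hu' hadj
        exact absurd (h.partner_inj (hF.map.notMem_out hu') huO (ih u' ⟨hr, e⟩ _ hu' hM)) e
  obtain ⟨u, hu⟩ := hF.surj hc (hT v hv).1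
  have hM := key u v hu hv
  cases hfu : f u with
  | none =>
    rw [partner_of_none hfu] at hM
    exact (hF.adj u v hu).ne hM
  | some y =>
    rw [partner_of_some hfu] at hM
    subst hM
    rw [(h.inverse u y).1 hfu] at hgv
    simp at hgv

/-- If a flow exists, it is the only family of disjoint paths that covers `O`: a maximal exception
`w` would have its image under the flow matched with a larger exception. -/
theorem IsFlow.eq_of_covered [Finite V] (hF : IsFlow G I O F r)
    (h : IsFamily G I O f g) (hO : ∀ v ∈ O, v ∉ I → g v ≠ none) : f = F := by
  have key : ∀ w y, F w = some y → partner f w = y := by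
    intro w
    induction w using hF.wellFounded_gt.induction with
    | _ w ih =>
      intro y hw
      have hwO := hF.map.notMem_out hw
      have hyI := hF.map.cod w y hw
      obtain ⟨u, huO, hu⟩ : ∃ u, u ∉ O ∧ partner f u = y := by
        cases hgy : g y with
        | none =>
          have hyO : y ∉ O := fun e => hO y e hyI hgy
          exact ⟨y, hyO, partner_of_none ((h.free y hyI hyO).2 hgy)⟩
        | some u =>
          have := (h.inverse u y).2 hgy
          exact ⟨u, h.notMem_out u y this, partner_of_some this⟩
      by_cases e : w = u
      · rwa [e]
      · have hr : r w u := by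
          rcases h.partner_adj u with e' | hadj
          · rw [← e', hu]
            exact hF.le_succ w y hw
          · exact hF.le_nbr w y u hw (hu ▸ hadj)
        obtain ⟨z, hz⟩ := hF.map.exists_eq_some huO
        have : z = y := (ih u ⟨hr, e⟩ z hz).symm.trans hu
        exact absurd (hF.inj hw (this ▸ hz)) e
  funext w
  by_cases hw : w ∈ O
  · rw [(hF.map.dom w).2 hw]
    by_contra hne
    obtain ⟨y, hy⟩ := Option.ne_none_iff_exists'.1 hne
    exact h.notMem_out w y hy hw
  · obtain ⟨y, hy⟩ := hF.map.exists_eq_some hw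
    have := key w y hy
    cases hfw : f w with
    | none =>
      rw [partner_of_none hfw] at this
      exact absurd this (hF.adj w y hy).ne
    | some z =>
      rw [partner_of_some hfw] at this
      rw [hy, this]

theorem IsFlow.naturalPreorder_le (hF : IsFlow G I O F r) {v w : V}
    (h : NaturalPreorder G F v w) : r v w := by
  induction h with
  | refl => exact hF.refl v
  | tail _ hbc ih =>
    obtain ⟨_, u, hu, rfl | hadj⟩ := hbc
    · exact hF.trans _ _ _ ih (hF.le_succ _ _ hu)
    · exact hF.trans _ _ _ ih (hF.le_nbr _ _ _ hu hadj)

theorem isFlow_naturalPreorder (hmap : IsMapCompl I O f)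
    (hadj : ∀ v u, f v = some u → G.Adj v u)
    (hanti : ∀ v w, NaturalPreorder G f v w → NaturalPreorder G f w v → v = w) :
    IsFlow G I O f (NaturalPreorder G f) where
  map := hmap
  refl _ := .refl
  trans _ _ _ := .trans
  antisymm := hanti
  adj := hadj
  le_succ v u h := .single ⟨(hadj v u h).ne, u, h, .inl rfl⟩
  le_nbr v u w h hw := by
    by_cases e : v = w
    · exact e ▸ .refl
    · exact .single ⟨e, u, h, .inr hw⟩

end Flow

/-! ### The number of edges of a geometry with a flow -/

section Extremal

variable {V : Type} {G : SimpleGraph V} {I O : Finset V} {F : V → Option V}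
  {r : V → V → Prop}

theorem IsFlow.exists_linear (h : IsFlow G I O F r) :
    ∃ s : V → V → Prop, (∀ u v, s u v ∨ s v u) ∧ IsFlow G I O F s := by
  have : IsPartialOrder V r :=
    { refl := h.refl, trans := h.trans, antisymm := h.antisymm }
  obtain ⟨s, hs, hle⟩ := extend_partialOrder r
  exact ⟨s, hs.total, h.map, hs.refl, hs.trans, hs.antisymm, h.adj,
    fun v u hv => hle _ _ (h.le_succ v u hv), fun v u w hv hw => hle _ _ (h.le_nbr v u w hv hw)⟩

/-- A geometry with a flow has at most `k * n - (k + 1).choose 2` edges, where `k` is the size of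
`O`. Add the vertices to the `k` vertices without predecessor in the order, made linear, of
their predecessors. When `y = f v` is added, its neighbours are at least `v`, and those of them
present by then are not the successor of a vertex that is at least `v`. As `f` is injective and
increasing, at most `k` vertices have both properties. -/
theorem IsFlow.card_adj_le [Fintype V] (h : IsFlow G I O F r) (hc : I.card = O.card)
    [DecidableRel G.Adj] :
    (Finset.univ.filter fun p : V × V => G.Adj p.1 p.2).card + O.card * (O.card + 1) ≤
      2 * (O.card * Fintype.card V) := by
  classical
  obtain ⟨s, htot, hs⟩ := h.exists_linear
  -- the ordered pairs of adjacent vertices of which the second is added after the first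
  let late : V × V → Prop := fun p => G.Adj p.1 p.2 ∧
    ∃ v, F v = some p.2 ∧ ¬ ∃ u, F u = some p.1 ∧ s v u
  have hback : ∀ v y, F v = some y →
      (Finset.univ.filter fun x => G.Adj x y ∧ ¬ ∃ u, F u = some x ∧ s v u).card ≤ O.card := by
    intro v y hv
    let A := Finset.univ.filter fun x => s v x
    let B := Finset.univ.filter fun x => G.Adj x y ∧ ¬ ∃ u, F u = some x ∧ s v u
    let C := (A \ O).image fun u => (F u).getD u
    have hCcard : C.card = (A \ O).card := by
      refine Finset.card_image_of_injOn fun a ha b hb e => ?_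
      obtain ⟨x, hx⟩ := hs.map.exists_eq_some (Finset.mem_sdiff.1 ha).2
      obtain ⟨z, hz⟩ := hs.map.exists_eq_some (Finset.mem_sdiff.1 hb).2
      have e' : x = z := by simpa [hx, hz] using e
      exact hs.inj hx (e' ▸ hz)
    have hCmem : ∀ x ∈ C, ∃ u, F u = some x ∧ s v u := by
      intro x hx
      obtain ⟨u, hu, rfl⟩ := Finset.mem_image.1 hx
      obtain ⟨hu, huO⟩ := Finset.mem_sdiff.1 hu
      obtain ⟨x, hx⟩ := hs.map.exists_eq_some huO
      exact ⟨u, by simp [hx], (Finset.mem_filter.1 hu).2⟩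
    have hdisj : Disjoint B C := Finset.disjoint_left.2 fun x hxB hxC =>
      (Finset.mem_filter.1 hxB).2.2 (hCmem x hxC)
    have hsub : B ∪ C ⊆ A := by
      intro x hx
      rcases Finset.mem_union.1 hx with hx | hx
      · exact Finset.mem_filter.2 ⟨Finset.mem_univ _,
          hs.le_nbr v y x hv (Finset.mem_filter.1 hx).2.1⟩
      · obtain ⟨u, hu, hvu⟩ := hCmem x hx
        exact Finset.mem_filter.2 ⟨Finset.mem_univ _, hs.trans _ _ _ hvu (hs.le_succ u x hu)⟩
    have h₁ := Finset.card_le_card hsub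
    rw [Finset.card_union_of_disjoint hdisj, hCcard] at h₁
    have h₂ := Finset.card_sdiff_add_card_inter A O
    have h₃ : (A ∩ O).card ≤ O.card := Finset.card_le_card Finset.inter_subset_right
    change B.card ≤ _
    omega
  have hlate : (Finset.univ.filter late).card ≤ (Finset.univ \ I).card * O.card := by
    have hmaps : ∀ p ∈ Finset.univ.filter late, p.2 ∈ Finset.univ \ I := by
      intro p hp
      obtain ⟨_, v, hv, _⟩ := (Finset.mem_filter.1 hp).2
      exact Finset.mem_sdiff.2 ⟨Finset.mem_univ _, hs.map.cod v _ hv⟩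
    rw [mul_comm]
    refine Finset.card_le_mul_card_image_of_maps_to hmaps _ fun y hy => ?_
    obtain ⟨v, hv⟩ := hs.surj hc (Finset.mem_sdiff.1 hy).2
    refine le_trans (Finset.card_le_card_of_injOn Prod.fst (fun p hp => ?_)
      fun p hp q hq e => ?_) (hback v y hv)
    · simp only [Finset.coe_filter, Finset.mem_filter, Finset.mem_univ, true_and,
        Set.mem_ofPred_eq] at hp ⊢
      obtain ⟨⟨hadj, v', hv', hp⟩, rfl⟩ := hp
      rw [hs.inj hv hv']
      exact ⟨hadj, hp⟩
    · simp only [Finset.coe_filter, Set.mem_ofPred_eq] at hp hq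
      exact Prod.ext e (hp.2.trans hq.2.symm)
  have hcover : (Finset.univ.filter fun p : V × V => G.Adj p.1 p.2) ⊆
      I.offDiag ∪ (Finset.univ.filter late ∪ (Finset.univ.filter late).image Prod.swap) := by
    rintro ⟨x, y⟩ hp
    have hadj : G.Adj x y := (Finset.mem_filter.1 hp).2
    simp only [Finset.mem_union, Finset.mem_offDiag, Finset.mem_filter, Finset.mem_univ, true_and,
      Finset.mem_image, Prod.exists, Prod.swap_prod_mk, Prod.mk.injEq]
    have hyx : ¬ late (x, y) → ¬ late (y, x) → x ∈ I ∧ y ∈ I := by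
      intro h₁ h₂
      replace h₁ : ∀ v, F v = some y → ∃ u, F u = some x ∧ s v u :=
        fun v hv => by_contra fun hn => h₁ ⟨hadj, v, hv, hn⟩
      replace h₂ : ∀ v, F v = some x → ∃ u, F u = some y ∧ s v u :=
        fun v hv => by_contra fun hn => h₂ ⟨hadj.symm, v, hv, hn⟩
      by_contra hne
      rw [not_and_or] at hne
      have hx : ∃ u, F u = some x ∧ ∃ v, F v = some y ∧ s u v := by
        rcases hne with hx | hy
        · obtain ⟨u, hu⟩ := hs.surj hc hx
          obtain ⟨v, hv⟩ := h₂ u hu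
          exact ⟨u, hu, v, hv⟩
        · obtain ⟨v, hv⟩ := hs.surj hc hy
          obtain ⟨u, hu, _⟩ := h₁ v hv
          obtain ⟨v', hv'⟩ := h₂ u hu
          exact ⟨u, hu, v', hv'⟩
      obtain ⟨u, hu, v, hv, huv⟩ := hx
      obtain ⟨u', hu', hvu⟩ := h₁ v hv
      obtain rfl := hs.inj hu hu'
      obtain rfl := hs.antisymm _ _ huv hvu
      exact hadj.ne (Option.some.inj (hu.symm.trans hv))
    by_cases h₁ : late (x, y)
    · exact .inr (.inl h₁)
    · by_cases h₂ : late (y, x)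
      · exact .inr (.inr ⟨y, x, h₂, rfl, rfl⟩)
      · exact .inl ⟨(hyx h₁ h₂).1, (hyx h₁ h₂).2, hadj.ne⟩
  have h₁ := (Finset.card_le_card hcover).trans ((Finset.card_union_le _ _).trans
    (Nat.add_le_add_left (Finset.card_union_le _ _) _))
  have h₂ : ((Finset.univ.filter late).image Prod.swap).card ≤ (Finset.univ.filter late).card :=
    Finset.card_image_le
  have h₃ : (Finset.univ \ I).card + I.card = Fintype.card V :=
    Finset.card_sdiff_add_card_eq_card (Finset.subset_univ I)
  rw [Finset.offDiag_card, hc] at h₁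
  rw [hc] at h₃
  rw [← h₃]
  have h₄ : O.card ≤ O.card * O.card := Nat.le_mul_self _
  zify [h₄] at h₁ h₂ hlate ⊢
  nlinarith

end Extremal

/-! ### Successor functions -/

section Successor

variable {V : Type} {G : SimpleGraph V} {I O : Finset V} {f g : V → Option V}

theorem exists_chain_to_end (hf : Acyclic f) (v : V) :
    ∃ l : List V, (v :: l).IsChain (fun a b => f a = some b) ∧
      ∀ x, (v :: l).getLast? = some x → f x = none := by
  induction v using hf.induction with
  | _ v ih =>
    cases hv : f v with
    | none => exact ⟨[], by simp, by simpa using hv⟩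
    | some w =>
      obtain ⟨l, h₁, h₂⟩ := ih w hv
      refine ⟨w :: l, List.isChain_cons_cons.2 ⟨hv, h₁⟩, fun x hx => h₂ x ?_⟩
      rwa [List.getLast?_cons_cons] at hx

theorem exists_chain_from_start [Finite V] (hf : Acyclic f) (v : V) (l : List V)
    (hl : (v :: l).IsChain (fun a b => f a = some b)) :
    ∃ l' : List V, (l' ++ v :: l).IsChain (fun a b => f a = some b) ∧
      ∀ x, (l' ++ v :: l).head? = some x → ∀ u, f u ≠ some x := by
  induction v using hf.wellFounded_pred.induction generalizing l with
  | _ v ih =>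
    by_cases hv : ∃ u, f u = some v
    · obtain ⟨u, hu⟩ := hv
      obtain ⟨l', h₁, h₂⟩ := ih u hu (v :: l) (List.isChain_cons_cons.2 ⟨hu, hl⟩)
      exact ⟨l' ++ [u], by simpa using h₁, by simpa using h₂⟩
    · exact ⟨[], hl, by simpa using hv⟩

/-- The part of a maximal orbit after one of its vertices is determined by this vertex. -/
theorem chain_unique {v : V} {l l' : List V}
    (h : (v :: l).IsChain (fun a b => f a = some b))
    (h' : (v :: l').IsChain (fun a b => f a = some b))
    (he : ∀ x, (v :: l).getLast? = some x → f x = none)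
    (he' : ∀ x, (v :: l').getLast? = some x → f x = none) : l = l' := by
  induction l generalizing v l' with
  | nil =>
    cases l' with
    | nil => rfl
    | cons b l' =>
      rw [List.isChain_cons_cons] at h'
      have := he v (by simp)
      rw [h'.1] at this
      simp at this
  | cons a l ih =>
    rw [List.isChain_cons_cons] at h
    cases l' with
    | nil =>
      have := he' v (by simp)
      rw [h.1] at this
      simp at this
    | cons b l' =>
      rw [List.isChain_cons_cons] at h'
      obtain rfl : a = b := Option.some.inj (h.1.symm.trans h'.1)
      rw [List.getLast?_cons_cons] at he he'
      rw [ih h.2 h'.2 he he']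

/-- The part of a maximal orbit before one of its vertices is determined by this vertex. -/
theorem start_unique (hinj : ∀ u v w, f u = some w → f v = some w → u = v) {v : V}
    {l l' m m' : List V} (h : (l ++ v :: m).IsChain (fun a b => f a = some b))
    (h' : (l' ++ v :: m').IsChain (fun a b => f a = some b))
    (hs : ∀ x, (l ++ v :: m).head? = some x → ∀ u, f u ≠ some x)
    (hs' : ∀ x, (l' ++ v :: m').head? = some x → ∀ u, f u ≠ some x) : l = l' := by
  induction l using List.reverseRecOn generalizing v l' m m' with
  | nil =>
    rcases l'.eq_nil_or_concat with rfl | ⟨L, b, rfl⟩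
    · rfl
    · simp only [List.concat_eq_append, List.append_assoc, List.cons_append,
        List.nil_append] at h'
      exact absurd (List.isChain_cons_cons.1 (List.isChain_append.1 h').2.1).1 (hs v (by simp) b)
  | append_singleton l a ih =>
    simp only [List.append_assoc, List.cons_append, List.nil_append] at h hs
    have ha := (List.isChain_cons_cons.1 (List.isChain_append.1 h).2.1).1
    rcases l'.eq_nil_or_concat with rfl | ⟨L, b, rfl⟩
    · exact absurd ha (hs' v (by simp) a)
    · simp only [List.concat_eq_append, List.append_assoc, List.cons_append,
        List.nil_append] at h' hs'
      have hb := (List.isChain_cons_cons.1 (List.isChain_append.1 h').2.1).1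
      obtain rfl := hinj a b v ha hb
      rw [ih h h' hs hs', List.concat_eq_append]

theorem isSuccessorFunction_of_acyclic [Finite V] (hmap : IsMapCompl I O f) (hf : Acyclic f)
    (hinj : ∀ u v w, f u = some w → f v = some w → u = v)
    (hadj : ∀ v u, f v = some u → G.Adj v u) : IsSuccessorFunction G I O f where
  map := hmap
  inj := hinj
  orbits :=
    { path := by
        rintro l ⟨hne, hl, -, -⟩
        refine ⟨hne, hl.imp hadj, ?_⟩
        have : l.IsChain (Relation.TransGen fun a b => f a = some b) :=
          hl.imp fun _ _ hab => .single hab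
        exact List.Pairwise.imp (S := (· ≠ ·)) (fun hab e => hf.irrefl (e ▸ hab)) this.pairwise
      cover := by
        intro v
        obtain ⟨l, hl, he⟩ := exists_chain_to_end hf v
        obtain ⟨l', hl', hs⟩ := exists_chain_from_start hf v l hl
        refine ⟨l' ++ v :: l, ⟨⟨by simp, hl', hs, ?_⟩, by simp⟩, ?_⟩
        · simpa [List.getLast?_append] using he
        · rintro m ⟨⟨-, hm, hms, hme⟩, hv⟩
          obtain ⟨m₁, m₂, rfl⟩ := List.append_of_mem hv
          rw [start_unique hinj hm hl' hms hs,
            chain_unique (List.isChain_append.1 hm).2.1 hl (by simpa using hme) he]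
      input := by
        rintro l ⟨-, hl, -, -⟩ v hv hvI
        obtain ⟨l₁, l₂, rfl⟩ := List.append_of_mem hv
        rcases l₁.eq_nil_or_concat with rfl | ⟨L, b, rfl⟩
        · simp
        · simp only [List.concat_eq_append, List.append_assoc, List.cons_append,
            List.nil_append] at hl
          have hb := (List.isChain_cons_cons.1 (List.isChain_append.1 hl).2.1).1
          exact absurd hvI (hmap.cod b v hb)
      output := by
        rintro l ⟨-, hl, -, he⟩ v hv
        refine ⟨fun hvO => ?_, fun h => (hmap.dom v).1 (he v h)⟩
        obtain ⟨l₁, l₂, rfl⟩ := List.append_of_mem hv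
        cases l₂ with
        | nil => simp
        | cons a l₂ =>
          have ha := (List.isChain_cons_cons.1 (List.isChain_append.1 hl).2.1).1
          rw [(hmap.dom v).2 hvO] at ha
          simp at ha }

end Successor

/-! ### The search for an augmentation -/

section Search

variable {V : Type} [Fintype V] {G : SimpleGraph V} {I O : Finset V}
  {D : Input G I O} {T : V → Prop} {b b' d : ℕ} {v : V} {s s' s₁ s₂ : Memory V}

/-- The vertex `x` has been searched from in the current round. -/
def Visited (s : Memory V) (x : V) : Prop := ¬ s.marked x < s.iter

/-- The vertices that have not been searched from in the current round. -/
def fresh (s : Memory V) : Finset V := Finset.univ.filter fun x => s.marked x < s.iter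

theorem mem_fresh {x : V} : x ∈ fresh s ↔ s.marked x < s.iter := by simp [fresh]

/-- The number of steps performed, together with the number of steps that may yet be performed at
the vertices not searched from in the current round: at most `12` for each iteration at a neighbour
and `12` for the rest of the call. -/
def searchPotential (D : Input G I O) (s : Memory V) : ℕ :=
  s.steps + ∑ x ∈ fresh s, 12 * ((D.nbrs x).length + 1)

/-- What holds whenever a search, or its loop over neighbours, is begun; `d` bounds the depth of
the recursive calls to come. -/
structure Ready (G : SimpleGraph V) (I O : Finset V) (d : ℕ) (s : Memory V) : Prop where
  fuel : (fresh s).card ≤ d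
  family : IsFamily G I O s.f s.g
  notFound : s.foundPath = false
  marked_le : ∀ x, s.marked x ≤ s.iter

/-- The arrays have not changed between `s` and `s'`, and each vertex that was searched from in
the meantime is closed under the search. -/
structure Failed (D : Input G I O) (b : ℕ) (s s' : Memory V) : Prop where
  f_eq : s'.f = s.f
  g_eq : s'.g = s.g
  iter_eq : s'.iter = s.iter
  marked_le : ∀ x, s'.marked x ≤ s'.iter
  mono : ∀ x, Visited s x → Visited s' x
  closed : ∀ x, Visited s' x → Visited s x ∨ SearchClosed G I O s'.f (Visited s') x
  potential : searchPotential D s' ≤ searchPotential D s + b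

/-- Between `s` and `s'` an alternating walk to `v` has been found, and the family of paths has
been augmented along it. -/
structure Succeeded (D : Input G I O) (T : V → Prop) (b : ℕ) (v : V) (s s' : Memory V) :
    Prop where
  augments : Augments G I O T v s.f s.g s'.f s'.g
  iter_eq : s'.iter = s.iter
  marked_le : ∀ x, s'.marked x ≤ s'.iter
  potential : searchPotential D s' ≤ searchPotential D s + b

/-- The possible outcomes of a search from `v`. -/
def Outcome (D : Input G I O) (T : V → Prop) (b : ℕ) (v : V) (s s' : Memory V) : Prop :=
  s'.foundPath = false ∧ Failed D b s s' ∨ s'.foundPath = true ∧ Succeeded D T b v s s'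

theorem Failed.tick (hs : ∀ x, s.marked x ≤ s.iter) (b : ℕ) :
    Failed D b s { s with steps := s.steps + b } where
  f_eq := rfl
  g_eq := rfl
  iter_eq := rfl
  marked_le := hs
  mono _ h := h
  closed _ h := .inl h
  potential := by simp [searchPotential, fresh]; omega

theorem Failed.trans (h : Failed D b s s₁) (h' : Failed D b' s₁ s₂) :
    Failed D (b + b') s s₂ where
  f_eq := h'.f_eq.trans h.f_eq
  g_eq := h'.g_eq.trans h.g_eq
  iter_eq := h'.iter_eq.trans h.iter_eq
  marked_le := h'.marked_le
  mono x hx := h'.mono x (h.mono x hx)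
  closed x hx := by
    rcases h'.closed x hx with hx | hx
    · refine (h.closed x hx).imp_right fun hc => ?_
      rw [h'.f_eq]
      exact hc.mono h'.mono
    · exact .inr hx
  potential := by have := h.potential; have := h'.potential; omega

theorem Failed.trans_succeeded (h : Failed D b s s₁) (h' : Succeeded D T b' v s₁ s₂) :
    Succeeded D T (b + b') v s s₂ where
  augments := h.f_eq ▸ h.g_eq ▸ h'.augments
  iter_eq := h'.iter_eq.trans h.iter_eq
  marked_le := h'.marked_le
  potential := by have := h.potential; have := h'.potential; omega

theorem Failed.trans_outcome (h : Failed D b s s₁) (h' : Outcome D T b' v s₁ s₂) :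
    Outcome D T (b + b') v s s₂ :=
  h'.imp (And.imp_right h.trans) (And.imp_right h.trans_succeeded)

theorem Failed.of_le (h : Failed D b s s') (hb : b ≤ b') : Failed D b' s s' :=
  { h with potential := h.potential.trans (Nat.add_le_add_left hb _) }

theorem Outcome.of_le (h : Outcome D T b v s s') (hb : b ≤ b') : Outcome D T b' v s s' :=
  h.imp (And.imp_right fun h => h.of_le hb) (And.imp_right fun h =>
    { h with potential := h.potential.trans (Nat.add_le_add_left hb _) })

theorem Failed.ready (h : Failed D b s s') (hs : Ready G I O d s) (hf : s'.foundPath = false) :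
    Ready G I O d s' where
  fuel := by
    refine (Finset.card_le_card fun x hx => ?_).trans hs.fuel
    rw [mem_fresh] at hx ⊢
    by_contra hn
    exact h.mono x hn hx
  family := h.f_eq ▸ h.g_eq ▸ hs.family
  notFound := hf
  marked_le := h.marked_le

/-- The vertices searched from remain closed under `f`, apart from a vertex `v` about to be
searched from. -/
theorem Failed.closed_f (h : Failed D b s s') (hfam : IsFamily G I O s.f s.g)
    (hc : ∀ x y, Visited s x → s.f x = some y → Visited s y ∨ y = v) (hv : Visited s' v)
    (x y : V) (hx : Visited s' x) (hy : s'.f x = some y) : Visited s' y := by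
  rcases h.closed x hx with hx | hx
  · rcases hc x y hx (h.f_eq ▸ hy) with hy | rfl
    exacts [h.mono y hy, hv]
  · have := hx.2.1 (hfam.notMem_out x y (h.f_eq ▸ hy))
    rwa [partner_of_some hy] at this

variable [DecidableEq V]

/-- The specification of the search, for calls of depth at most `d`. -/
def SearchSpec (D : Input G I O) (d : ℕ) (p : V → Proc V Unit) : Prop :=
  ∀ v s, Ready G I O d s → s.marked v < s.iter →
    (∀ x y, Visited s x → s.f x = some y → Visited s y ∨ y = v) →
    Runs (p v) s fun _ s' => Outcome D (Visited s) 0 v s s' ∧ (s'.foundPath = false →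
      Visited s' v ∧ ∀ x ∈ O, s.g x = none → Visited s' x → Visited s x ∨ x = v)

/-- The loop of the search over the neighbours of `v`. It is begun when `v` and all vertices after
`v` on its path have been searched from, so that the vertices searched from are closed under `f`.
The set `T` is that of the vertices searched from before `v`. -/
theorem runs_searchLoop {search : V → Proc V Unit} (hsearch : SearchSpec D d search) (hvI : v ∉ I)
    (hvT : ¬ T v) (l : List V) (hl : ∀ w ∈ l, G.Adj w v) (s : Memory V) (hs : Ready G I O d s)
    (hT : ∀ x, T x → Visited s x) (hv : Visited s v)
    (hc : ∀ x y, Visited s x → s.f x = some y → Visited s y) :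
    Runs (searchLoop search D v l) s fun _ s' =>
      Outcome D T (12 * l.length + 1) v s s' ∧
        (s'.foundPath = false → (∀ w ∈ l, w ∉ O → Visited s' (partner s.f w)) ∧
          ∀ x ∈ O, s.g x = none → Visited s' x → Visited s x) := by
  induction l generalizing s with
  | nil =>
    rw [searchLoop, runs_step]
    exact ⟨.inl ⟨hs.notFound, .tick hs.marked_le 1⟩, fun _ => ⟨by simp, fun _ _ _ h => h⟩⟩
  | cons w l ih =>
    have hwv : G.Adj w v := hl w (by simp)
    -- continue with the rest of the loop, the neighbour `w` being dealt with
    have next : ∀ s₁, Failed D 12 s s₁ → s₁.foundPath = false →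
        (w ∉ O → Visited s₁ (partner s.f w)) →
        (∀ x y, Visited s₁ x → s₁.f x = some y → Visited s₁ y) →
        (∀ x ∈ O, s.g x = none → Visited s₁ x → Visited s x) →
        Runs (searchLoop search D v l) s₁ fun _ s' =>
          Outcome D T (12 * (w :: l).length + 1) v s s' ∧
            (s'.foundPath = false → (∀ u ∈ w :: l, u ∉ O → Visited s' (partner s.f u)) ∧
              ∀ x ∈ O, s.g x = none → Visited s' x → Visited s x) := by
      intro s₁ h hf hw hc₁ hu₁
      refine (ih (fun u hu => hl u (by simp [hu])) s₁ (h.ready hs hf)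
        (fun x hx => h.mono x (hT x hx)) (h.mono v hv) hc₁).mono fun _ s' ⟨hO, hd⟩ => ⟨?_, ?_⟩
      · exact (h.trans_outcome hO).of_le (by simp; omega)
      · refine fun hf' => ⟨fun u hu huO => ?_, fun x hx hg hv =>
          hu₁ x hx hg ((hd hf').2 x hx (h.g_eq ▸ hg) hv)⟩
        rcases List.mem_cons.1 hu with rfl | hu
        · rcases hO with ⟨-, hO⟩ | ⟨hO, -⟩
          · exact hO.mono _ (hw huO)
          · simp [hf'] at hO
        · rw [← h.f_eq]
          exact (hd hf').1 u hu huO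
    have tick : ∀ {n}, n ≤ 12 → Failed D 12 s { s with steps := s.steps + n } := fun hn =>
      (Failed.tick hs.marked_le _).of_le hn
    rw [searchLoop]
    simp only [runs_bind, runs_step, getMarked, getIter, runs_load, runs_test, runs_ite,
      decide_eq_true_eq]
    split_ifs with hw
    · obtain ⟨hwO, hw⟩ := hw
      replace hwO : w ∉ O := fun e => by simp [(D.isOut_iff w).2 e] at hwO
      -- a call from the state `s₁` which differs from `s` in its steps
      have call : ∀ (y : V) (s₁ : Memory V) (n : ℕ), n ≤ 9 →
          s₁ = { s with steps := s.steps + n } → s.marked y < s.iter → partner s.f w = y →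
          Runs (search y) s₁ fun _ s' =>
            Runs (do
              if ← getFoundPath then
                setF w (some v)
                setG v (some w)
              else
                searchLoop search D v l) s' fun _ s' =>
              Outcome D T (12 * (w :: l).length + 1) v s s' ∧
                (s'.foundPath = false → (∀ u ∈ w :: l, u ∉ O → Visited s' (partner s.f u)) ∧
                  ∀ x ∈ O, s.g x = none → Visited s' x → Visited s x) := by
        intro y s₁ n hn hs₁ hy hwy
        have h₁ : Failed D n s s₁ := hs₁ ▸ Failed.tick hs.marked_le n
        have hr : Ready G I O d s₁ := h₁.ready hs (by rw [hs₁]; exact hs.notFound)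
        refine (hsearch y s₁ hr (by rw [hs₁]; exact hy) (fun x z hx hz => ?_)).mono
          fun _ s' ⟨hO, hd⟩ => ?_
        · subst hs₁
          exact .inl (hc x z hx hz)
        simp only [runs_bind, getFoundPath, setF, setG, runs_load, runs_store, runs_ite]
        rcases hO with ⟨hf, hO⟩ | ⟨hf, hO⟩
        · rw [if_neg (by simp [hf])]
          have h₂ := (h₁.trans hO).trans (Failed.tick hO.marked_le 1)
          refine next _ (h₂.of_le (by omega)) hf (fun _ => ?_) ?_ ?_
          · rw [hwy]
            exact (hd hf).1
          · refine h₂.closed_f (v := y) hs.family (fun x z hx hz => .inl (hc x z hx hz)) ?_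
            exact (hd hf).1
          · subst hs₁
            refine fun x hx hg hx' => ((hd hf).2 x hx hg hx').resolve_right ?_
            rintro rfl
            cases hfw : s.f w with
            | none => exact hwO ((partner_of_none hfw).symm.trans hwy ▸ hx)
            | some z =>
              rw [partner_of_some hfw] at hwy
              subst hwy
              rw [(hs.family.inverse w z).1 hfw] at hg
              simp at hg
        · rw [if_pos hf]
          refine ⟨.inr ⟨hf, ?_⟩, fun e => by simp [hf] at e⟩
          subst hs₁
          refine ⟨?_, hO.iter_eq, hO.marked_le, ?_⟩
          · have hcl : ∀ x z, Visited { s with steps := s.steps + n } x → s.f x = some z →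
              Visited { s with steps := s.steps + n } z := hc
            cases hfw : s.f w with
            | none =>
              rw [partner_of_none hfw] at hwy
              subst hwy
              exact hO.augments.attach_uncovered hs.family hvI hvT hwv hwO hfw (not_not.2 hw) hT
                hv hcl
            | some y₀ =>
              rw [partner_of_some hfw] at hwy
              subst hwy
              exact hO.augments.attach_covered hs.family hvI hvT hwv hwO hfw (not_not.2 hw)
                (not_not.2 hy) hT hv hcl
          · have := hO.potential
            simp only [searchPotential, fresh, List.length_cons] at this ⊢
            omega
      cases hfw : s.f w with
      | none =>
        simp only [getF, runs_load, runs_bind, hfw]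
        have := call w _ 5 (by omega) rfl hw (partner_of_none hfw)
        simpa only [runs_bind] using this
      | some y =>
        simp only [getF, runs_load, runs_bind, hfw, runs_test, runs_ite, decide_eq_true_eq]
        split_ifs with hy
        · have := call y _ 8 (by omega) rfl hy (partner_of_some hfw)
          simpa only [runs_bind, runs_ite] using this
        · exact next _ (tick (n := 8) (by omega)) hs.notFound
            (fun _ => by rw [partner_of_some hfw]; exact hy) hc (fun _ _ _ h => h)
    · refine next _ (tick (n := 4) (by omega)) hs.notFound (fun hwO => ?_) hc
        (fun _ _ _ h => h)
      have hw' : Visited s w := fun h => hw ⟨by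
        rw [← Bool.not_eq_true, D.isOut_iff]; exact hwO, h⟩
      cases hfw : s.f w with
      | none => rw [partner_of_none hfw]; exact hw'
      | some y => rw [partner_of_some hfw]; exact hc w y hw' hfw

theorem searchSpec_alternPathSearch (D : Input G I O) (d : ℕ) :
    SearchSpec D d (alternPathSearch D d) := by
  induction d with
  | zero =>
    intro v s hs hv
    have := Finset.card_pos.2 ⟨v, mem_fresh.2 hv⟩
    have := hs.fuel
    omega
  | succ d ih =>
    intro v s hs hv hc
    -- the memory after `v` is marked, up to the number of steps
    let s₁ : Memory V := { s with marked := Function.update s.marked v s.iter }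
    have hvT : ¬ Visited s v := not_not.2 hv
    have hfresh : fresh s₁ = (fresh s).erase v := by
      ext x
      rw [Finset.mem_erase, mem_fresh, mem_fresh]
      by_cases e : x = v
      · subst e; simp [s₁]
      · simp [s₁, e]
    have hvis : ∀ x, Visited s₁ x ↔ Visited s x ∨ x = v := by
      intro x
      by_cases e : x = v
      · subst e; simp [s₁, Visited]
      · simp [s₁, Visited, e]
    have hle₁ : ∀ x, s₁.marked x ≤ s₁.iter := by
      intro x
      by_cases e : x = v
      · subst e; simp [s₁]
      · simpa [s₁, Function.update_of_ne e] using hs.marked_le x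
    have hpot : searchPotential D s₁ + 12 * ((D.nbrs v).length + 1) = searchPotential D s := by
      have := Finset.sum_erase_add (fresh s) (fun x => 12 * ((D.nbrs x).length + 1))
        (mem_fresh.2 hv)
      simp only [searchPotential, hfresh]
      change s.steps + _ + _ = _
      omega
    have hr₁ : Ready G I O d s₁ := by
      refine ⟨?_, hs.family, hs.notFound, hle₁⟩
      have h₁ := Finset.card_erase_add_one (mem_fresh.2 hv)
      have h₂ := hs.fuel
      rw [hfresh]
      omega
    have hv₁ : Visited s₁ v := (hvis v).2 (.inr rfl)
    have hc₁ : ∀ x y, v ∉ I → Visited s₁ x → s₁.f x = some y → Visited s₁ y ∨ s₁.f v = some y := by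
      intro x y hvI hx hy
      rcases (hvis x).1 hx with hx | rfl
      · exact .inl ((hvis y).2 (hc x y hx hy))
      · exact .inr hy
    have succ : ∀ {n s'}, n ≤ 12 * ((D.nbrs v).length + 1) →
        Succeeded D (Visited s) n v s₁ s' → Succeeded D (Visited s) 0 v s s' := by
      intro n s' hn h
      refine ⟨h.augments, h.iter_eq, h.marked_le, ?_⟩
      have := h.potential
      omega
    have loop : ∀ s₂, v ∉ I → Failed D 11 s₁ s₂ → s₂.foundPath = false →
        (∀ y, s.f v = some y → Visited s₂ y) →
        (∀ x ∈ O, s.g x = none → Visited s₂ x → Visited s₁ x) →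
        Runs (searchLoop (alternPathSearch D d) D v (D.nbrs v)) s₂ fun _ s' =>
          Outcome D (Visited s) 0 v s s' ∧ (s'.foundPath = false →
            Visited s' v ∧ ∀ x ∈ O, s.g x = none → Visited s' x → Visited s x ∨ x = v) := by
      intro s₂ hvI h hf hfv hu₂
      refine (runs_searchLoop (T := Visited s) ih hvI hvT (D.nbrs v)
        (fun w hw => ((D.mem_nbrs v w).1 hw).symm) s₂ (h.ready hr₁ hf)
        (fun x hx => h.mono x ((hvis x).2 (.inl hx))) (h.mono v hv₁) ?_).mono
        fun _ s' ⟨hO, hd⟩ => ?_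
      · intro x y hx hy
        rcases h.closed x hx with hx' | hx'
        · rcases hc₁ x y hvI hx' (h.f_eq ▸ hy) with hy' | hy'
          exacts [h.mono y hy', hfv y hy']
        · have := hx'.2.1 (hs.family.notMem_out x y (h.f_eq ▸ hy))
          rwa [partner_of_some hy] at this
      have hO' := h.trans_outcome hO
      rcases hO' with ⟨hf', hO'⟩ | ⟨hf', hO'⟩
      · have hv' : Visited s' v := hO'.mono v hv₁
        refine ⟨.inl ⟨hf', hO'.f_eq, hO'.g_eq, hO'.iter_eq, hO'.marked_le,
          fun x hx => hO'.mono x ((hvis x).2 (.inl hx)), fun x hx => ?_, ?_⟩,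
          fun _ => ⟨hv', fun x hx hg hx' =>
            (hvis x).1 (hu₂ x hx hg ((hd hf').2 x hx (h.g_eq ▸ hg) hx'))⟩⟩
        · rcases hO'.closed x hx with hx' | hx'
          · rcases (hvis x).1 hx' with hx' | rfl
            · exact .inl hx'
            · refine .inr ⟨hvI, fun _ => ?_, fun w hw hwO => ?_⟩
              · cases hfx : s'.f x with
                | none => rwa [partner_of_none hfx]
                | some y =>
                  rw [partner_of_some hfx]
                  rcases hO with ⟨_, hO⟩ | ⟨hO, _⟩
                  · refine hO.mono y (hfv y ?_)
                    rw [← hfx, hO'.f_eq]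
                  · simp [hf'] at hO
              · have := (hd hf').1 w ((D.mem_nbrs x w).2 hw) hwO
                rwa [h.f_eq, ← hO'.f_eq] at this
          · exact .inr hx'
        · have := hO'.potential
          omega
      · exact ⟨.inr ⟨hf', succ (by omega) hO'⟩, fun e => by simp [hf'] at e⟩
    rw [alternPathSearch]
    simp only [runs_bind, runs_step, getIter, getMarked, setMarked, setFoundPath, runs_load,
      runs_store, runs_test, runs_ite, decide_eq_true_eq]
    split_ifs with hvI
    · rw [D.isIn_iff] at hvI
      refine ⟨.inr ⟨rfl, hs.family.augments_of_mem hvI, rfl, hle₁, ?_⟩, fun e => by simp at e⟩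
      simp only [searchPotential, fresh, s₁] at hpot ⊢
      omega
    · replace hvI : v ∉ I := fun e => hvI ((D.isIn_iff v).2 e)
      cases hfv : s.f v with
      | none =>
        simp only [getF, runs_load, hfv]
        exact loop _ hvI ((Failed.tick (s := s₁) hle₁ 5).of_le (by omega)) hs.notFound
          (fun y hy => by simp [hfv] at hy) (fun _ _ _ h => h)
      | some w =>
        simp only [getF, runs_load, runs_bind, hfv, runs_test, runs_ite, decide_eq_true_eq]
        split_ifs with hw
        · have hwT : ¬ Visited s w := fun h => (hvis w).2 (.inl h) hw
          have hcw : ∀ x y, Visited s₁ x → s₁.f x = some y → Visited s₁ y ∨ y = w := by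
            intro x y hx hy
            refine (hc₁ x y hvI hx hy).imp_right fun e => ?_
            exact Option.some.inj (e.symm.trans hfv)
          have h₁ : Failed D 8 s₁ { s₁ with steps := s₁.steps + 8 } := .tick hle₁ 8
          refine (ih w _ (h₁.ready hr₁ hs.notFound) hw hcw).mono fun _ s' ⟨hO, hd⟩ => ?_
          simp only [getFoundPath, setF, setG, runs_load, runs_store]
          rcases hO with ⟨hf, hO⟩ | ⟨hf, hO⟩
          · rw [if_neg (by simp [hf])]
            refine loop _ hvI (((h₁.trans hO).trans (Failed.tick hO.marked_le 1)).of_le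
              (by omega)) hf (fun y hy => ?_) fun x hx hg hx' => ?_
            · obtain rfl := Option.some.inj (hfv.symm.trans hy)
              exact (hd hf).1
            · refine ((hd hf).2 x hx hg hx').resolve_right ?_
              rintro rfl
              rw [(hs.family.inverse v x).1 hfv] at hg
              simp at hg
          · rw [if_pos hf]
            refine ⟨.inr ⟨hf, succ (n := 11) (by omega) ⟨?_, hO.iter_eq, hO.marked_le, ?_⟩⟩,
              fun e => by simp [hf] at e⟩
            · exact hO.augments.discard hs.family hvI hvT hfv hwT
                (fun x hx => (hvis x).2 (.inl hx)) hv₁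
            · have := hO.potential
              simp only [searchPotential, fresh] at this ⊢
              omega
        · refine loop _ hvI ((Failed.tick (s := s₁) hle₁ 8).of_le (by omega)) hs.notFound
            (fun y hy => ?_) (fun _ _ _ h => h)
          obtain rfl := Option.some.inj (hfv.symm.trans hy)
          exact hw

end Search

section Rounds

variable {V : Type} [DecidableEq V]

theorem runs_forEach_reset (l : List V) (s : Memory V) :
    Runs (forEach (fun v => do
      setMarked v 0
      setF v none
      setG v none) l) s fun _ s' => s'.iter = s.iter ∧ s'.steps = s.steps + (4 * l.length + 1) ∧
      ∀ x, x ∈ l ∨ s.marked x = 0 ∧ s.f x = none ∧ s.g x = none →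
        s'.marked x = 0 ∧ s'.f x = none ∧ s'.g x = none := by
  induction l generalizing s with
  | nil =>
    rw [forEach, runs_step]
    exact ⟨rfl, rfl, by simp⟩
  | cons v l ih =>
    rw [forEach]
    simp only [runs_bind, runs_step, setMarked, setF, setG, runs_store]
    refine (ih _).mono fun _ s' ⟨h₁, h₂, h₃⟩ => ⟨h₁, ?_, fun x hx => h₃ x ?_⟩
    · rw [h₂, List.length_cons]
      dsimp only
      omega
    · dsimp only
      by_cases e : x = v
      · subst e; simp
      · simpa [e] using hx

variable [Fintype V] {G : SimpleGraph V} {I O : Finset V} {d : ℕ}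

/-- A round of searches. An uncovered element of `O` can be searched from only at the outset of a
search, since other calls are for vertices outside of `O` or with a predecessor; so each search of
the round starts at a vertex that is not marked. -/
theorem runs_iterSearchLoop (D : Input G I O) (l : List V) (hlO : ∀ v ∈ l, v ∈ O) (hnd : l.Nodup)
    (s : Memory V) (hs : Ready G I O d s)
    (hcl : ∀ x, Visited s x → SearchClosed G I O s.f (Visited s) x)
    (hl : ∀ v ∈ l, s.g v = none → ¬ Visited s v) :
    Runs (iterSearchLoop D d l) s fun _ s' =>
      s'.iter = s.iter ∧ (∀ x, s'.marked x ≤ s'.iter) ∧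
      searchPotential D s' ≤ searchPotential D s + (5 * l.length + 1) ∧
      (s'.foundPath = false ∧ s'.f = s.f ∧ s'.g = s.g ∧
          (∀ x, Visited s' x → SearchClosed G I O s'.f (Visited s') x) ∧
          (∀ v, Visited s v → Visited s' v) ∧
          (∀ v ∈ l, v ∉ I → s.g v = none → Visited s' v) ∨
        s'.foundPath = true ∧ IsFamily G I O s'.f s'.g ∧
          (∀ y ∈ O, s.g y ≠ none → s'.g y ≠ none) ∧
          ∃ v ∈ O, v ∉ I ∧ s.g v = none ∧ s'.g v ≠ none) := by
  induction l generalizing s with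
  | nil =>
    rw [iterSearchLoop, runs_step]
    have h := Failed.tick (D := D) hs.marked_le 1
    exact ⟨rfl, h.marked_le, h.potential, .inl ⟨hs.notFound, rfl, rfl, hcl, h.mono, by simp⟩⟩
  | cons v l ih =>
    have hvl : v ∉ l := (List.nodup_cons.1 hnd).1
    have next : ∀ s₁, Failed D 5 s s₁ → s₁.foundPath = false →
        (∀ u ∈ l, s.g u = none → ¬ Visited s₁ u) →
        (v ∉ I → s.g v = none → Visited s₁ v) →
        Runs (iterSearchLoop D d l) s₁ fun _ s' =>
          s'.iter = s.iter ∧ (∀ x, s'.marked x ≤ s'.iter) ∧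
          searchPotential D s' ≤ searchPotential D s + (5 * (v :: l).length + 1) ∧
          (s'.foundPath = false ∧ s'.f = s.f ∧ s'.g = s.g ∧
              (∀ x, Visited s' x → SearchClosed G I O s'.f (Visited s') x) ∧
              (∀ v, Visited s v → Visited s' v) ∧
              (∀ u ∈ v :: l, u ∉ I → s.g u = none → Visited s' u) ∨
            s'.foundPath = true ∧ IsFamily G I O s'.f s'.g ∧
              (∀ y ∈ O, s.g y ≠ none → s'.g y ≠ none) ∧
              ∃ v ∈ O, v ∉ I ∧ s.g v = none ∧ s'.g v ≠ none) := by
      intro s₁ h hf hu hv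
      have hcl₁ : ∀ x, Visited s₁ x → SearchClosed G I O s₁.f (Visited s₁) x := by
        intro x hx
        rcases h.closed x hx with hx | hx
        · rw [h.f_eq]
          exact (hcl x hx).mono h.mono
        · exact hx
      refine (ih (fun u hu => hlO u (by simp [hu])) (List.nodup_cons.1 hnd).2 s₁
        (h.ready hs hf) hcl₁ (fun u hu' hg => hu u hu' (h.g_eq ▸ hg))).mono
        fun _ s' ⟨h₁, h₂, h₃, h₄⟩ => ⟨h₁.trans h.iter_eq, h₂, ?_, ?_⟩
      · have := h.potential
        rw [List.length_cons]
        omega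
      · rw [h.f_eq, h.g_eq] at h₄
        refine h₄.imp_left fun ⟨hf', h₅, h₆, h₇, h₈, h₉⟩ =>
          ⟨hf', h₅, h₆, h₇, fun x hx => h₈ x (h.mono x hx), fun u hu huI hg => ?_⟩
        rcases List.mem_cons.1 hu with rfl | hu
        · exact h₈ u (hv huI hg)
        · exact h₉ u hu huI hg
    rw [iterSearchLoop]
    simp only [runs_bind, runs_step, getG, runs_load, runs_test, runs_ite, decide_eq_true_eq]
    have tick : ∀ n, Failed D n s { s with steps := s.steps + n } := .tick hs.marked_le
    split_ifs with hv
    · obtain ⟨hvI, hgv⟩ := hv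
      replace hvI : v ∉ I := fun e => by simp [(D.isIn_iff v).2 e] at hvI
      have hvO : v ∈ O := hlO v (by simp)
      have hr : Ready G I O d { s with steps := s.steps + 3 } := (tick 3).ready hs hs.notFound
      refine (searchSpec_alternPathSearch D d v _ hr (not_not.1 (hl v (by simp) hgv))
        (fun x y hx hy => ?_)).mono fun _ s' ⟨hO, hd⟩ => ?_
      · have := (hcl x hx).2.1 (hs.family.notMem_out x y hy)
        rw [partner_of_some hy] at this
        exact .inl this
      · simp only [getFoundPath, runs_load, runs_pure]
        rcases hO with ⟨hf, hO⟩ | ⟨hf, hO⟩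
        · rw [if_neg (by simp [hf])]
          refine next _ ((((tick 3).trans hO).trans (Failed.tick hO.marked_le 1)).of_le (by omega))
            hf (fun u hu hg hu' => ?_) fun _ _ => (hd hf).1
          rcases (hd hf).2 u (hlO u (by simp [hu])) hg hu' with h | rfl
          · exact hl u (by simp [hu]) hg h
          · exact hvl hu
        · rw [if_pos hf]
          refine ⟨hO.iter_eq, hO.marked_le, ?_, .inr ⟨hf, hO.augments.isFamily hs.family hvO hgv,
            fun y hy hg => ?_, v, hvO, hvI, hgv, hO.augments.covered_self hvO hvI⟩⟩
          · have := hO.potential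
            simp only [searchPotential, fresh, List.length_cons] at this ⊢
            omega
          · exact hO.augments.covered y hy (fun e => hg (e ▸ hgv)) hg
    · refine next _ ((tick 3).of_le (by omega)) hs.notFound
        (fun u hu => hl u (by simp [hu])) fun hvI hg => absurd ⟨?_, hg⟩ hv
      rw [← Bool.not_eq_true, D.isIn_iff]
      exact hvI

/-- The elements of `O` that are yet to be joined to `I`. -/
def uncovered (I O : Finset V) (g : V → Option V) : Finset V :=
  (O \ I).filter fun v => g v = none

/-- Each round but the last covers another element of `O`. In the end, the vertices marked in the
last round form a set `T` that is closed under the search. -/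
theorem runs_buildPathsLoop (D : Input G I O) (hd : Fintype.card V ≤ d) (r : ℕ) (s : Memory V)
    (hfam : IsFamily G I O s.f s.g) (hle : ∀ x, s.marked x ≤ s.iter)
    (hr : (uncovered I O s.g).card < r) :
    Runs (buildPathsLoop D d r) s fun _ s' =>
      IsFamily G I O s'.f s'.g ∧
      (∃ T : V → Prop, (∀ x, T x → SearchClosed G I O s'.f T x) ∧
        ∀ v ∈ O, v ∉ I → s'.g v = none → T v) ∧
      s'.steps ≤ s.steps + ((uncovered I O s.g).card + 1) *
        (5 * D.outs.length + 6 + ∑ x, 12 * ((D.nbrs x).length + 1)) := by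
  induction r generalizing s with
  | zero => omega
  | succ r ih =>
    rw [buildPathsLoop]
    simp only [runs_bind, runs_step, getIter, setIter, setFoundPath, getFoundPath, runs_load,
      runs_store, runs_ite, runs_pure]
    have hvis : ∀ x, ¬ Visited { s with
        iter := s.iter + 1, foundPath := false, steps := s.steps + 4 } x :=
      fun x hx => hx (Nat.lt_succ_of_le (hle x))
    refine (runs_iterSearchLoop D D.outs (fun v hv => (D.mem_outs v).1 hv) D.outs_nodup
      { s with iter := s.iter + 1, foundPath := false, steps := s.steps + 4 }
      ⟨(Finset.card_le_univ _).trans hd, hfam, rfl, fun x => (hle x).trans (Nat.le_succ _)⟩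
      (fun x hx => absurd hx (hvis x)) (fun v _ _ => hvis v)).mono
      fun _ s' ⟨h₁, h₂, h₃, h₄⟩ => ?_
    have hsteps : s'.steps + 1 ≤ s.steps +
        (5 * D.outs.length + 6 + ∑ x, 12 * ((D.nbrs x).length + 1)) := by
      have : ∑ x ∈ fresh { s with iter := s.iter + 1, foundPath := false, steps := s.steps + 4 },
          12 * ((D.nbrs x).length + 1) ≤ ∑ x, 12 * ((D.nbrs x).length + 1) :=
        Finset.sum_le_sum_of_subset (Finset.subset_univ _)
      simp only [searchPotential] at h₃
      omega
    rcases h₄ with ⟨hf, hf', hg', hcl, -, hall⟩ | ⟨hf, hfam', hmono, v, hvO, hvI, hgv, hgv'⟩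
    · rw [if_neg (by simp [hf])]
      refine ⟨by rw [hf', hg']; exact hfam, ⟨Visited s', hcl, fun v hv hvI hg =>
        hall v ((D.mem_outs v).2 hv) hvI (by rwa [hg'] at hg)⟩, hsteps.trans ?_⟩
      exact Nat.add_le_add_left (Nat.le_mul_of_pos_left _ (Nat.succ_pos _)) _
    · rw [if_pos hf]
      have hlt : (uncovered I O s'.g).card < (uncovered I O s.g).card := by
        refine Finset.card_lt_card ⟨fun x hx => ?_, fun h => ?_⟩
        · simp only [uncovered, Finset.mem_filter, Finset.mem_sdiff] at hx ⊢
          exact ⟨hx.1, by_contra fun hg => hmono x hx.1.1 hg hx.2⟩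
        · have hgv₀ : s.g v = none := hgv
          have hv : v ∈ uncovered I O s.g := by simp [uncovered, hvO, hvI, hgv₀]
          exact hgv' (Finset.mem_filter.1 (h hv)).2
      refine (ih { s' with steps := s'.steps + 1 } hfam' h₂
        (Nat.lt_of_lt_of_le hlt (Nat.le_of_lt_succ hr))).mono
        fun _ s'' ⟨h₅, h₆, h₇⟩ => ⟨h₅, h₆, ?_⟩
      have := Nat.mul_le_mul_right
        (5 * D.outs.length + 6 + ∑ x, 12 * ((D.nbrs x).length + 1)) (Nat.succ_le_succ hlt)
      simp only [Nat.succ_eq_add_one] at this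
      rw [add_mul, one_mul] at this
      dsimp only at h₇
      omega

theorem runs_obtainMaxFamilyPaths (D : Input G I O) (hd : Fintype.card V ≤ d)
    (hd' : O.card < d) (s : Memory V) :
    Runs (obtainMaxFamilyPaths D d) s fun _ s' =>
      IsFamily G I O s'.f s'.g ∧
      (∃ T : V → Prop, (∀ x, T x → SearchClosed G I O s'.f T x) ∧
        ∀ v ∈ O, v ∉ I → s'.g v = none → T v) ∧
      s'.steps ≤ s.steps + 4 * D.verts.length + 3 + (O.card + 1) *
        (5 * D.outs.length + 6 + ∑ x, 12 * ((D.nbrs x).length + 1)) := by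
  rw [obtainMaxFamilyPaths]
  simp only [runs_bind, runs_step, setIter, runs_store]
  refine (runs_forEach_reset D.verts _).mono fun _ s₁ ⟨h₁, h₂, h₃⟩ => ?_
  have h₄ := fun x => h₃ x (.inl (D.mem_verts x))
  have hU : (uncovered I O s₁.g).card ≤ O.card :=
    Finset.card_le_card ((Finset.filter_subset _ _).trans Finset.sdiff_subset)
  refine (runs_buildPathsLoop D hd d s₁ ?_ (fun x => by simp [h₄ x]) (by omega)).mono
    fun _ s' ⟨h₅, h₆, h₇⟩ => ⟨h₅, h₆, h₇.trans ?_⟩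
  · exact
      { acyclic := ⟨fun x => ⟨x, fun y hy => by simp [(h₄ x).2.1] at hy⟩⟩
        notMem_out := fun w y hw => by simp [(h₄ w).2.1] at hw
        notMem_in := fun w y hw => by simp [(h₄ w).2.1] at hw
        adj := fun w y hw => by simp [(h₄ w).2.1] at hw
        inverse := fun w y => by simp [(h₄ w).2.1, (h₄ y).2.2]
        free := fun x _ _ => by simp [(h₄ x).2.1, (h₄ x).2.2] }
  · have := Nat.mul_le_mul_right
      (5 * D.outs.length + 6 + ∑ x, 12 * ((D.nbrs x).length + 1)) (Nat.succ_le_succ hU)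
    simp only [Nat.succ_eq_add_one] at this
    rw [h₂]
    dsimp only
    omega

end Rounds

/-! ### Labelling the paths -/

section Labels

variable {V : Type} {f g : V → Option V}

/-- The vertex `u` precedes `w`, or equals it, on a path of the family with successor function
`f`. -/
def Reaches (f : V → Option V) : V → V → Prop := Relation.ReflTransGen fun a b => f a = some b

open Classical in
/-- The initial segment of a path that ends with `w`. -/
noncomputable def segment [Fintype V] (f : V → Option V) (w : V) : Finset V :=
  Finset.univ.filter fun u => Reaches f u w

theorem mem_segment [Fintype V] {u w : V} : u ∈ segment f w ↔ Reaches f u w := by simp [segment]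

theorem reaches_iff_of_none (hinv : IsInverse f g) {u w : V} (hw : g w = none) :
    Reaches f u w ↔ u = w := by
  refine ⟨fun h => ?_, fun h => h ▸ .refl⟩
  rcases Relation.ReflTransGen.cases_tail h with h | ⟨c, -, hc⟩
  · exact h.symm
  · rw [(hinv c w).1 hc] at hw
    simp at hw

theorem reaches_iff_of_some (hinv : IsInverse f g) {u w y : V} (hw : g w = some y) :
    Reaches f u w ↔ u = w ∨ Reaches f u y := by
  constructor
  · intro h
    rcases Relation.ReflTransGen.cases_tail h with h | ⟨c, hc, hcw⟩
    · exact .inl h.symm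
    · have := (hinv c w).1 hcw
      rw [hw] at this
      exact .inr (Option.some.inj this ▸ hc)
  · rintro (rfl | h)
    · exact .refl
    · exact h.tail ((hinv y w).2 hw)

theorem card_segment_of_none [Fintype V] (hinv : IsInverse f g) {w : V} (hw : g w = none) :
    (segment f w).card = 1 := by
  have : segment f w = {w} := by
    ext u
    rw [mem_segment, reaches_iff_of_none hinv hw, Finset.mem_singleton]
  rw [this, Finset.card_singleton]

theorem not_reaches_pred (hf : Acyclic f) (hinv : IsInverse f g) {w y : V} (hw : g w = some y) :
    ¬ Reaches f w y := fun h =>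
  hf.irrefl (Relation.TransGen.tail' h ((hinv y w).2 hw))

theorem card_segment_of_some [Fintype V] (hf : Acyclic f) (hinv : IsInverse f g) {w y : V}
    (hw : g w = some y) : (segment f w).card = (segment f y).card + 1 := by
  classical
  have : segment f w = insert w (segment f y) := by
    ext u
    rw [mem_segment, reaches_iff_of_some hinv hw, Finset.mem_insert, mem_segment]
  rw [this, Finset.card_insert_of_notMem]
  rw [mem_segment]
  exact not_reaches_pred hf hinv hw

/-- Two vertices on the same path are in the order of the lengths of their initial segments. -/
theorem reaches_of_card_le [Fintype V]
    (hinj : ∀ u v w, f u = some w → f v = some w → u = v) {u v w : V} (hu : Reaches f u w)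
    (hv : Reaches f v w) (hc : (segment f u).card ≤ (segment f v).card) : Reaches f u v := by
  have huniq : Relator.RightUnique (Function.swap fun a b => f a = some b) :=
    fun _ _ _ hab hac => hinj _ _ _ hab hac
  have hu' := Relation.reflTransGen_swap.2 hu
  have hv' := Relation.reflTransGen_swap.2 hv
  rcases Relation.ReflTransGen.total_of_right_unique huniq hu' hv' with h | h
  · have h := Relation.reflTransGen_swap.1 h
    have hsub : segment f v ⊆ segment f u := fun x hx =>
      mem_segment.2 ((mem_segment.1 hx).trans h)
    have := Finset.eq_of_subset_of_card_le hsub hc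
    exact mem_segment.1 (this ▸ mem_segment.2 .refl)
  · exact Relation.reflTransGen_swap.1 h

theorem reaches_end_unique {x w w' : V}
    (hw : f w = none) (hw' : f w' = none) (h : Reaches f x w) (h' : Reaches f x w') : w = w' := by
  have huniq : Relator.RightUnique fun a b => f a = some b :=
    fun _ _ _ hab hac => Option.some.inj (hab.symm.trans hac)
  have key : ∀ {a b : V}, f a = none → Reaches f a b → a = b := by
    intro a b ha hab
    rcases Relation.ReflTransGen.cases_head hab with e | ⟨c, hc, -⟩
    · exact e
    · simp [ha] at hc
  rcases Relation.ReflTransGen.total_of_right_unique huniq h h' with h | h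
  · exact key hw h
  · exact (key hw' h).symm

variable [Fintype V]

/-- The entries of `x` are initialized, and `x` has a label. -/
structure Initialized (k : ℕ) (s : Memory V) (x : V) : Prop where
  dist : s.dist x + 1 = (segment s.f x).card
  inf : ∀ p, 1 ≤ p → p ≤ k → s.inf x p = if p = s.path x then (s.dist x : ℤ) else -1
  status : s.status x = .untouched

/-- The entries of `x` are the same in `s` and `s'`. -/
structure SameAt (s s' : Memory V) (x : V) : Prop where
  dist : s'.dist x = s.dist x
  path : s'.path x = s.path x
  inf : s'.inf x = s.inf x
  status : s'.status x = s.status x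

theorem SameAt.initialized {s s' : Memory V} {x : V} {k : ℕ} (h : SameAt s s' x)
    (hf : s'.f = s.f) (hx : Initialized k s x) : Initialized k s' x where
  dist := by rw [h.dist, hf, hx.dist]
  inf p h₁ h₂ := by rw [h.inf, h.path, h.dist, hx.inf p h₁ h₂]
  status := h.status.trans hx.status

end Labels

section InitializePath

variable {V : Type} [DecidableEq V]

theorem runs_forEach_setInf (w : V) (P : ℕ) (l : List ℕ) (s : Memory V) :
    Runs (forEach (fun p => do
      if ← test (p = P) then
        setInf w p (← getDist w)
      else
        setInf w p (-1)) l) s fun _ s' =>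
      ∃ inf : V → ℕ → ℤ, ∃ n ≤ 4 * l.length + 1,
        s' = { s with inf := inf, steps := s.steps + n } ∧ (∀ x, x ≠ w → inf x = s.inf x) ∧
        ∀ p, (p ∈ l ∨ s.inf w p = if p = P then (s.dist w : ℤ) else -1) →
          inf w p = if p = P then (s.dist w : ℤ) else -1 := by
  induction l generalizing s with
  | nil =>
    rw [forEach, runs_step]
    exact ⟨s.inf, 1, by simp, rfl, fun _ _ => rfl, by simp⟩
  | cons p l ih =>
    -- the effect of the first iteration, in `n` steps
    have next : ∀ n ≤ 4, Runs (forEach (fun p => do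
          if ← test (p = P) then
            setInf w p (← getDist w)
          else
            setInf w p (-1)) l)
        { s with
          inf := Function.update s.inf w (Function.update (s.inf w) p
            (if p = P then (s.dist w : ℤ) else -1))
          steps := s.steps + n } fun _ s' =>
        ∃ inf : V → ℕ → ℤ, ∃ n ≤ 4 * (p :: l).length + 1,
          s' = { s with inf := inf, steps := s.steps + n } ∧ (∀ x, x ≠ w → inf x = s.inf x) ∧
          ∀ q, (q ∈ p :: l ∨ s.inf w q = if q = P then (s.dist w : ℤ) else -1) →
            inf w q = if q = P then (s.dist w : ℤ) else -1 := by
      intro n hn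
      refine (ih _).mono ?_
      rintro _ _ ⟨inf, m, hm, rfl, h₁, h₂⟩
      refine ⟨inf, n + m, by rw [List.length_cons]; omega, by simp [Nat.add_assoc],
        fun x hx => by simp [h₁ x hx, hx], fun q hq => h₂ q ?_⟩
      by_cases e : q = p
      · subst e; simp
      · simpa [e] using hq
    rw [forEach]
    simp only [runs_bind, runs_step, runs_test, runs_ite, decide_eq_true_eq, getDist, setInf,
      runs_load, runs_store]
    split_ifs with h
    · have := next 4 le_rfl
      rw [if_pos h] at this
      exact this
    · have := next 3 (by omega)
      rw [if_neg h] at this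
      exact this

theorem runs_initializeVertex (k : ℕ) (w : V) (P : ℕ) (s : Memory V) :
    Runs (initializeVertex k w P) s fun _ s' =>
      ∃ inf : V → ℕ → ℤ, ∃ n ≤ 4 * k + 3,
        s' = { s with
          path := Function.update s.path w P
          inf := inf
          status := Function.update s.status w .untouched
          steps := s.steps + n } ∧
        (∀ x, x ≠ w → inf x = s.inf x) ∧
        ∀ p, 1 ≤ p → p ≤ k → inf w p = if p = P then (s.dist w : ℤ) else -1 := by
  rw [initializeVertex]
  simp only [runs_bind, setPath, setStatus, runs_store]
  refine (runs_forEach_setInf w P _ _).mono ?_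
  rintro _ _ ⟨inf, n, hn, rfl, h₁, h₂⟩
  rw [List.length_range'] at hn
  refine ⟨inf, n + 2, by omega, by simp; omega, h₁, fun p hp hpk => h₂ p (.inl ?_)⟩
  rw [List.mem_range'_1]
  omega

variable [Fintype V]

theorem runs_initializePath (k P : ℕ) (w : V) (d : ℕ) (s : Memory V) (hf : Acyclic s.f)
    (hinv : IsInverse s.f s.g) (hd : (segment s.f w).card ≤ d) :
    Runs (initializePath k P d w) s fun _ s' =>
      s'.f = s.f ∧ s'.g = s.g ∧ s'.nextPath = s.nextPath ∧
      (∀ x, Reaches s.f x w → Initialized k s' x ∧ s'.path x = P) ∧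
      (∀ x, ¬ Reaches s.f x w → SameAt s s' x) ∧
      s'.steps ≤ s.steps + (4 * k + 7) * (segment s.f w).card := by
  induction d generalizing w s with
  | zero =>
    have := Finset.card_pos.2 ⟨w, mem_segment.2 (.refl : Reaches s.f w w)⟩
    omega
  | succ d ih =>
    rw [initializePath]
    simp only [runs_bind, runs_step, getG, runs_load]
    cases hw : s.g w with
    | none =>
      have hseg := card_segment_of_none hinv hw
      simp only [runs_bind, setDist, runs_store]
      refine (runs_initializeVertex k w P _).mono ?_
      rintro _ _ ⟨inf, n, hn, rfl, h₁, h₂⟩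
      refine ⟨rfl, rfl, rfl, fun x hx => ?_, fun x hx => ?_, ?_⟩
      · obtain rfl := (reaches_iff_of_none hinv hw).1 hx
        exact ⟨⟨by simp [hseg], fun p hp hpk => by simp [h₂ p hp hpk], by simp⟩, by simp⟩
      · have e : x ≠ w := fun e => hx (e ▸ .refl)
        exact ⟨by simp [e], by simp [e], h₁ x e, by simp [e]⟩
      · rw [hseg]
        dsimp only
        omega
    | some y =>
      have hseg := card_segment_of_some hf hinv hw
      simp only [runs_bind, getDist, setDist, runs_load, runs_store]
      refine (ih y { s with steps := s.steps + 2 } hf hinv (by dsimp only; omega)).mono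
        fun _ s₁ ⟨hf₁, hg₁, hn₁, hin, hout, hsteps⟩ => ?_
      dsimp only at hf₁ hg₁ hn₁ hin hout hsteps
      refine (runs_initializeVertex k w P _).mono ?_
      rintro _ _ ⟨inf, n, hn, rfl, h₁, h₂⟩
      refine ⟨hf₁, hg₁, hn₁, fun x hx => ?_, fun x hx => ?_, ?_⟩
      · by_cases e : x = w
        · subst e
          have hy := (hin y .refl).1.dist
          rw [hf₁] at hy
          exact ⟨⟨by simp [hf₁, hseg, ← hy], fun p hp hpk => by simp [h₂ p hp hpk], by simp⟩,
            by simp⟩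
        · have hxy := ((reaches_iff_of_some hinv hw).1 hx).resolve_left e
          refine ⟨SameAt.initialized (s := s₁) ⟨?_, ?_, ?_, ?_⟩ rfl (hin x hxy).1, ?_⟩
          · simp [e]
          · simp [e]
          · exact h₁ x e
          · simp [e]
          · simpa [e] using (hin x hxy).2
      · rw [reaches_iff_of_some hinv hw, not_or] at hx
        have := hout x hx.2
        exact ⟨by simpa [hx.1] using this.dist, by simpa [hx.1] using this.path,
          (h₁ x hx.1).trans this.inf, by simpa [hx.1] using this.status⟩
      · rw [hseg, mul_add]
        dsimp only
        omega

/-- The labels in `s` of the vertices in `A` are smaller than `P`, and different on different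
paths. -/
structure Labelled (k : ℕ) (A : V → Prop) (P : ℕ) (s : Memory V) : Prop where
  initialized : ∀ x, A x → Initialized k s x
  pos : ∀ x, A x → 1 ≤ s.path x
  lt : ∀ x, A x → s.path x < P
  samePath : ∀ x y, A x → A y →
    (s.path x = s.path y ↔ ∃ w, s.f w = none ∧ Reaches s.f x w ∧ Reaches s.f y w)

theorem runs_forEach_initializePath (k d : ℕ) (l : List V) (hnd : l.Nodup) (P : ℕ)
    (A : V → Prop) (s : Memory V) (hf : Acyclic s.f) (hinv : IsInverse s.f s.g) (hP : 1 ≤ P)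
    (hnext : s.nextPath = P) (hl : ∀ w ∈ l, s.f w = none) (hd : Fintype.card V ≤ d)
    (hA : ∀ x w, A x → w ∈ l → ¬ Reaches s.f x w) (hs : Labelled k A P s) :
    Runs (forEach (fun w => do
      initializePath k (← getNextPath) d w
      setNextPath ((← getNextPath) + 1)) l) s fun _ s' =>
      s'.f = s.f ∧ s'.g = s.g ∧
      Labelled k (fun x => A x ∨ ∃ w ∈ l, Reaches s.f x w) (P + l.length) s' ∧
      s'.steps ≤ s.steps + (4 * l.length + 1) +
        (4 * k + 7) * (l.map fun w => (segment s.f w).card).sum := by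
  induction l generalizing s P A with
  | nil =>
    rw [forEach, runs_step]
    refine ⟨rfl, rfl, ⟨?_, ?_, ?_, ?_⟩, by simp⟩
    · rintro x (hx | ⟨w, hw, -⟩)
      · exact SameAt.initialized (s := s) ⟨rfl, rfl, rfl, rfl⟩ rfl (hs.initialized x hx)
      · simp at hw
    · simpa using hs.pos
    · simpa using hs.lt
    · simpa using hs.samePath
  | cons w l ih =>
    rw [forEach]
    simp only [runs_bind, runs_step, getNextPath, setNextPath, runs_load, runs_store]
    refine (runs_initializePath k s.nextPath w d { s with steps := s.steps + 2 } hf hinv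
      ((Finset.card_le_univ _).trans hd)).mono
      fun _ s₁ ⟨hf₁, hg₁, hn₁, hin, hout, hsteps⟩ => ?_
    dsimp only at hf₁ hg₁ hn₁ hin hout hsteps
    have hsame : ∀ x, A x → SameAt s s₁ x := fun x hx =>
      have h := hout x (hA x w hx (by simp))
      ⟨h.dist, h.path, h.inf, h.status⟩
    have hlab : Labelled k (fun x => A x ∨ Reaches s.f x w) (P + 1) s₁ := by
      refine ⟨?_, ?_, ?_, ?_⟩
      · rintro x (hx | hx)
        · exact (hsame x hx).initialized hf₁ (hs.initialized x hx)
        · exact (hin x hx).1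
      · rintro x (hx | hx)
        · rw [(hsame x hx).path]
          exact hs.pos x hx
        · rw [(hin x hx).2, hnext]
          exact hP
      · rintro x (hx | hx)
        · rw [(hsame x hx).path]
          exact (hs.lt x hx).trans (Nat.lt_succ_self P)
        · rw [(hin x hx).2, hnext]
          exact Nat.lt_succ_self P
      · rw [hf₁]
        have hw : s.f w = none := hl w (by simp)
        rintro x y (hx | hx) (hy | hy)
        · rw [(hsame x hx).path, (hsame y hy).path]
          exact hs.samePath x y hx hy
        · rw [(hsame x hx).path, (hin y hy).2, hnext]
          refine iff_of_false (hs.lt x hx).ne ?_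
          rintro ⟨u, hu, hxu, hyu⟩
          obtain rfl := reaches_end_unique hw hu hy hyu
          exact hA x w hx (by simp) hxu
        · rw [(hsame y hy).path, (hin x hx).2, hnext]
          refine iff_of_false (hs.lt y hy).ne' ?_
          rintro ⟨u, hu, hxu, hyu⟩
          obtain rfl := reaches_end_unique hw hu hx hxu
          exact hA y w hy (by simp) hyu
        · rw [(hin x hx).2, (hin y hy).2]
          exact iff_of_true rfl ⟨w, hw, hx, hy⟩
    have hdisj : ∀ x u, (A x ∨ Reaches s.f x w) → u ∈ l → ¬ Reaches s₁.f x u := by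
      rw [hf₁]
      rintro x u (hx | hx) hu hxu
      · exact hA x u hx (by simp [hu]) hxu
      · have := reaches_end_unique (hl w (by simp)) (hl u (by simp [hu])) hx hxu
        exact (List.nodup_cons.1 hnd).1 (this ▸ hu)
    refine (ih (List.nodup_cons.1 hnd).2 (P + 1) (fun x => A x ∨ Reaches s.f x w)
      { s₁ with nextPath := s₁.nextPath + 1, steps := s₁.steps + 2 } (hf₁ ▸ hf)
      (hf₁.symm ▸ hg₁.symm ▸ hinv) (by omega) (by dsimp only; rw [hn₁, hnext])
      (fun u hu => by dsimp only; rw [hf₁]; exact hl u (by simp [hu])) hdisj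
      ⟨fun x hx => ?_, hlab.pos, hlab.lt, hlab.samePath⟩).mono
      fun _ s' ⟨hf', hg', hlab', hsteps'⟩ => ?_
    · exact SameAt.initialized (s := s₁) ⟨rfl, rfl, rfl, rfl⟩ rfl (hlab.initialized x hx)
    · dsimp only at hf' hg' hlab' hsteps'
      refine ⟨hf'.trans hf₁, hg'.trans hg₁, ?_, ?_⟩
      · have e : (fun x => A x ∨ ∃ u ∈ w :: l, Reaches s.f x u) =
            fun x => (A x ∨ Reaches s.f x w) ∨ ∃ u ∈ l, Reaches s₁.f x u := by
          funext x
          simp [hf₁, or_assoc]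
        rw [e, List.length_cons, Nat.add_comm l.length, ← Nat.add_assoc]
        exact hlab'
      · rw [hf₁] at hsteps'
        rw [List.map_cons, List.sum_cons, List.length_cons, Nat.mul_add (4 * k + 7)]
        omega

end InitializePath

/-! ### The search for the infima of the natural pre-order -/

section Calls

variable {V : Type} {G : SimpleGraph V} {I O : Finset V} {f g : V → Option V}

/-- At the neighbour `z` of `w`, the search from `w` calls itself for `v`. -/
def CallsVia (f : V → Option V) (w z v : V) : Prop :=
  f w ≠ some z ∧ (f z = some w ∧ v = z ∨ f z ≠ some w ∧ f v = some z)

/-- The search from `w` calls itself for `v`. -/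
def Calls (G : SimpleGraph V) (f : V → Option V) (v w : V) : Prop :=
  ∃ z, G.Adj w z ∧ CallsVia f w z v

theorem influences_of_calls {v w : V} (hc : Calls G f v w) :
    Influences G f v w := by
  obtain ⟨z, hz, hwz, ⟨hzw, rfl⟩ | ⟨-, hv⟩⟩ := hc
  · exact ⟨hz.ne', w, hzw, .inl rfl⟩
  · exact ⟨fun e => hwz (e ▸ hv), z, hv, .inr hz⟩

theorem IsFamily.not_two_cycle (h : IsFamily G I O f g) {v w : V} (hv : f v = some w)
    (hw : f w = some v) : False :=
  h.acyclic.irrefl (.tail (.single hv) hw)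

theorem IsFamily.calls_of_some (h : IsFamily G I O f g) {v w : V} (hv : f v = some w) :
    Calls G f v w :=
  ⟨v, (h.adj v w hv).symm, fun hw => h.not_two_cycle hv hw, .inl ⟨hv, rfl⟩⟩

/-- The calls omit only influences that are composed of two others. -/
theorem IsFamily.naturalPreorder_eq (h : IsFamily G I O f g) :
    NaturalPreorder G f = Relation.ReflTransGen (Calls G f) := by
  funext v w
  refine propext ⟨fun hvw => ?_, fun hvw =>
    Relation.ReflTransGen.mono (fun _ _ => influences_of_calls) _ _ hvw⟩
  induction hvw with
  | refl => exact .refl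
  | @tail b c _ hbc ih =>
    refine ih.trans ?_
    obtain ⟨hne, z, hb, rfl | hz⟩ := hbc
    · exact .single (h.calls_of_some hb)
    · by_cases hzc : f z = some c
      · exact .tail (.single (h.calls_of_some hb)) (h.calls_of_some hzc)
      · exact .single ⟨z, hz, fun hc => hne (h.inj hb hc), .inr ⟨hzc, hb⟩⟩

theorem IsFamily.reaches_le (h : IsFamily G I O f g) {v w : V} (hvw : Reaches f v w) :
    NaturalPreorder G f v w := by
  rw [h.naturalPreorder_eq]
  exact Relation.ReflTransGen.mono (fun _ _ => h.calls_of_some) _ _ hvw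

end Calls

section AugmentInf

variable {V : Type} [DecidableEq V]

theorem runs_augmentInf (k : ℕ) {w v : V} (hvw : v ≠ w) (s : Memory V) :
    Runs (augmentInf k w v) s fun _ s' =>
      ∃ inf : V → ℕ → ℤ, ∃ n ≤ 5 * k + 1, s' = { s with inf := inf, steps := s.steps + n } ∧
        (∀ x, x ≠ w → inf x = s.inf x) ∧
        ∀ p, 1 ≤ p → p ≤ k → inf w p = max (s.inf w p) (s.inf v p) := by
  have key : ∀ (l : List ℕ) (s : Memory V),
      Runs (forEach (fun p => do
        let a ← getInf v p
        if ← test ((← getInf w p) < a) then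
          setInf w p a
        else
          pure ()) l) s fun _ s' =>
      ∃ inf : V → ℕ → ℤ, ∃ n ≤ 5 * l.length + 1,
        s' = { s with inf := inf, steps := s.steps + n } ∧
        (∀ x, x ≠ w → inf x = s.inf x) ∧
        ∀ p, inf w p = if p ∈ l then max (s.inf w p) (s.inf v p) else s.inf w p := by
    intro l
    induction l with
    | nil =>
      intro s
      rw [forEach, runs_step]
      exact ⟨s.inf, 1, by simp, rfl, fun _ _ => rfl, by simp⟩
    | cons p l ih =>
      intro s
      have next : ∀ n ≤ 5, Runs (forEach (fun p => do
            let a ← getInf v p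
            if ← test ((← getInf w p) < a) then
              setInf w p a
            else
              pure ()) l)
          { s with
            inf := Function.update s.inf w
              (Function.update (s.inf w) p (max (s.inf w p) (s.inf v p)))
            steps := s.steps + n } fun _ s' =>
          ∃ inf : V → ℕ → ℤ, ∃ n ≤ 5 * (p :: l).length + 1,
            s' = { s with inf := inf, steps := s.steps + n } ∧
            (∀ x, x ≠ w → inf x = s.inf x) ∧
            ∀ q, inf w q = if q ∈ p :: l then max (s.inf w q) (s.inf v q) else s.inf w q := by
        intro n hn
        refine (ih _).mono ?_
        rintro _ _ ⟨inf, m, hm, rfl, h₁, h₂⟩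
        refine ⟨inf, n + m, by rw [List.length_cons]; omega, by simp [Nat.add_assoc],
          fun x hx => by simp [h₁ x hx, hx], fun q => ?_⟩
        rw [h₂ q]
        by_cases e : q = p
        · subst e; simp [hvw]
        · simp [e, hvw]
      rw [forEach]
      simp only [runs_bind, runs_step, runs_test, runs_ite, decide_eq_true_eq, getInf, setInf,
        runs_load, runs_store, runs_pure]
      split_ifs with h
      · have := next 5 le_rfl
        rw [max_eq_right h.le] at this
        exact this
      · have := next 4 (by omega)
        rw [max_eq_left (not_lt.1 h), Function.update_eq_self, Function.update_eq_self] at this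
        exact this
  refine (key _ s).mono ?_
  rintro _ _ ⟨inf, n, hn, rfl, h₁, h₂⟩
  rw [List.length_range'] at hn
  refine ⟨inf, n, hn, rfl, h₁, fun p hp hpk => ?_⟩
  rw [h₂ p, if_pos]
  rw [List.mem_range'_1]
  omega

end AugmentInf

section FindInfima

variable {V : Type} [Fintype V] {G : SimpleGraph V} {I O : Finset V}
  {D : Input G I O} {k b b' d : ℕ} {s s' s₁ : Memory V}

/-- The vertices for which no search for infima has been called. -/
def untouched (s : Memory V) : Finset V :=
  Finset.univ.filter fun x => s.status x = .untouched

theorem mem_untouched {x : V} : x ∈ untouched s ↔ s.status x = .untouched := by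
  simp [untouched]

/-- The number of steps performed, together with the number of steps that may yet be performed at
the untouched vertices: an iteration at a neighbour takes at most `5 * k + 11` steps, of which
`5 * k + 1` are for the update of `Inf` and `3` for a call that returns at once. -/
def infimaPotential (D : Input G I O) (k : ℕ) (s : Memory V) : ℕ :=
  s.steps + ∑ x ∈ untouched s, ((5 * k + 11) * (D.nbrs x).length + 2)

/-- The entries of `Inf` describe the paths at untouched vertices and the natural pre-order at
complete ones, and no search leads from a complete vertex back to itself. -/
structure Sound (G : SimpleGraph V) (I O : Finset V) (k : ℕ) (s : Memory V) : Prop where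
  family : IsFamily G I O s.f s.g
  path_pos : ∀ x, 1 ≤ s.path x
  path_le : ∀ x, s.path x ≤ k
  notFound : s.foundCircuit = false
  initial : ∀ x, s.status x = .untouched → ∀ v,
    (s.dist v : ℤ) ≤ s.inf x (s.path v) ↔ Reaches s.f v x
  acc : ∀ x, s.status x = .complete → Acc (Calls G s.f) x
  complete : ∀ x, s.status x = .complete → ∀ v, Calls G s.f v x → s.status v = .complete
  infima : ∀ x, s.status x = .complete → ∀ v,
    (s.dist v : ℤ) ≤ s.inf x (s.path v) ↔ NaturalPreorder G s.f v x

/-- The arrays that describe the paths have not changed, and at most `b` steps have been charged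
to other vertices than those touched between `s` and `s'`. -/
structure Kept (D : Input G I O) (k b : ℕ) (s s' : Memory V) : Prop where
  f_eq : s'.f = s.f
  g_eq : s'.g = s.g
  dist_eq : s'.dist = s.dist
  path_eq : s'.path = s.path
  potential : infimaPotential D k s' ≤ infimaPotential D k s + b

/-- The effect of a call that finds no circuit. -/
structure Completes (s s' : Memory V) : Prop where
  incomplete : ∀ x, s'.status x = .incomplete ↔ s.status x = .incomplete
  inf_eq : ∀ x, s.status x = .incomplete → s'.inf x = s.inf x
  mono : ∀ x, s.status x = .complete → s'.status x = .complete

theorem Kept.tick (b : ℕ) : Kept D k b s { s with steps := s.steps + b } :=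
  ⟨rfl, rfl, rfl, rfl, by simp [infimaPotential, untouched]; omega⟩

theorem Kept.trans (h : Kept D k b s s₁) (h' : Kept D k b' s₁ s') : Kept D k (b + b') s s' where
  f_eq := h'.f_eq.trans h.f_eq
  g_eq := h'.g_eq.trans h.g_eq
  dist_eq := h'.dist_eq.trans h.dist_eq
  path_eq := h'.path_eq.trans h.path_eq
  potential := by have := h.potential; have := h'.potential; omega

theorem Kept.of_le (h : Kept D k b s s') (hb : b ≤ b') : Kept D k b' s s' :=
  { h with potential := h.potential.trans (Nat.add_le_add_left hb _) }

theorem Completes.card_untouched_le (h : Completes s s') :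
    (untouched s').card ≤ (untouched s).card := by
  refine Finset.card_le_card fun x hx => ?_
  rw [mem_untouched] at hx ⊢
  cases hs : s.status x with
  | untouched => rfl
  | incomplete => simp [(h.incomplete x).2 hs] at hx
  | complete => simp [h.mono x hs] at hx

variable [DecidableEq V]

/-- The specification of the search for infima, for calls of depth at most `d`. -/
def FindSpec (D : Input G I O) (k d : ℕ) (find : V → Proc V Unit) : Prop :=
  ∀ w s, Sound G I O k s → (untouched s).card < d →
    (∀ x, s.status x = .incomplete → Relation.TransGen (Calls G s.f) w x) →
    Runs (find w) s fun _ s' => Kept D k 3 s s' ∧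
      (s'.foundCircuit = true ∧ (∃ x, Relation.TransGen (Calls G s.f) x x) ∨
        Sound G I O k s' ∧ Completes s s' ∧ s'.status w = .complete)

/-- The loop of the search for the infima of `w` over the neighbours of `w`. The set `S` is that of
the vertices called for so far; the entries of `Inf` at `w` are maxima over `S` and the path of
`w`. Incomplete vertices are those whose calls have led to `w`. -/
theorem runs_predLoop {find : V → Proc V Unit} (hfind : FindSpec D k d find) (w : V)
    (l : List V) (hl : ∀ z ∈ l, G.Adj w z) (S : V → Prop) (s : Memory V)
    (hs : Sound G I O k s) (hd : (untouched s).card < d) (hw : s.status w = .incomplete)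
    (hinc : ∀ x, s.status x = .incomplete → Relation.ReflTransGen (Calls G s.f) w x)
    (hS : ∀ v, S v → Calls G s.f v w ∧ s.status v = .complete)
    (hSl : ∀ z, G.Adj w z → z ∈ l ∨ ∀ v, CallsVia s.f w z v → S v)
    (hinf : ∀ v, (s.dist v : ℤ) ≤ s.inf w (s.path v) ↔
      Reaches s.f v w ∨ ∃ u, S u ∧ NaturalPreorder G s.f v u) :
    Runs (predLoop find k w l) s fun _ s' => Kept D k ((5 * k + 11) * l.length + 2) s s' ∧
      (s'.foundCircuit = true ∧ (∃ x, Relation.TransGen (Calls G s.f) x x) ∨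
        Sound G I O k s' ∧
        (∀ x, s'.status x = .incomplete ↔ s.status x = .incomplete ∧ x ≠ w) ∧
        (∀ x, s.status x = .incomplete → x ≠ w → s'.inf x = s.inf x) ∧
        (∀ x, s.status x = .complete → s'.status x = .complete) ∧ s'.status w = .complete) := by
  induction l generalizing S s with
  | nil =>
    rw [predLoop]
    simp only [runs_bind, runs_step, setStatus, runs_store]
    have hSw : ∀ v, Calls G s.f v w → S v := by
      rintro v ⟨z, hz, hv⟩
      exact ((hSl z hz).resolve_left (by simp)) v hv
    have hcomp : ∀ x, Function.update s.status w .complete x = .complete ↔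
        x = w ∨ s.status x = .complete := by
      intro x
      by_cases e : x = w
      · subst e; simp
      · simp [e]
    have hunt : ∀ x, Function.update s.status w .complete x = .untouched ↔
        s.status x = .untouched := by
      intro x
      by_cases e : x = w
      · subst e; simp [hw]
      · simp [e]
    refine ⟨⟨rfl, rfl, rfl, rfl, ?_⟩, .inr ⟨?_, ?_, fun x _ _ => trivial, ?_, by simp⟩⟩
    · simp only [infimaPotential, untouched, hunt, List.length_nil]
      omega
    · refine
        { hs with
          initial := fun x hx => hs.initial x ((hunt x).1 hx)
          acc := fun x hx => ?_
          complete := fun x hx v hv => (hcomp v).2 (.inr ?_)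
          infima := fun x hx => ?_ }
      · rcases (hcomp x).1 hx with rfl | hx
        · exact ⟨_, fun v hv => hs.acc v (hS v (hSw v hv)).2⟩
        · exact hs.acc x hx
      · rcases (hcomp x).1 hx with rfl | hx
        · exact (hS v (hSw v hv)).2
        · exact hs.complete x hx v hv
      · rcases (hcomp x).1 hx with rfl | hx
        · refine fun v => (hinf v).trans ?_
          rw [hs.family.naturalPreorder_eq]
          constructor
          · rintro (h | ⟨u, hu, h⟩)
            · exact hs.family.naturalPreorder_eq ▸ hs.family.reaches_le h
            · exact h.tail (hS u hu).1
          · intro h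
            rcases Relation.ReflTransGen.cases_tail h with h | ⟨u, hvu, hu⟩
            · exact .inl (h ▸ .refl)
            · exact .inr ⟨u, hSw u hu, hvu⟩
        · exact hs.infima x hx
    · intro x
      by_cases e : x = w
      · subst e; simp
      · simp [e]
    · exact fun x hx => (hcomp x).2 (.inr hx)
  | cons z l ih =>
    have hwz : G.Adj w z := hl z (by simp)
    -- continue with the rest of the loop, when `S'` are the vertices called for
    have next : ∀ (S' : V → Prop) (s₁ : Memory V), Kept D k (5 * k + 11) s s₁ →
        Sound G I O k s₁ →
        (∀ x, s₁.status x = .incomplete ↔ s.status x = .incomplete) →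
        (∀ x, s.status x = .incomplete → x ≠ w → s₁.inf x = s.inf x) →
        (∀ x, s.status x = .complete → s₁.status x = .complete) →
        (untouched s₁).card < d →
        (∀ v, S' v → Calls G s.f v w ∧ s₁.status v = .complete) →
        (∀ v, S v → S' v) → (∀ v, CallsVia s.f w z v → S' v) →
        (∀ v, (s₁.dist v : ℤ) ≤ s₁.inf w (s₁.path v) ↔
          Reaches s.f v w ∨ ∃ u, S' u ∧ NaturalPreorder G s.f v u) →
        Runs (predLoop find k w l) s₁ fun _ s' =>
          Kept D k ((5 * k + 11) * (z :: l).length + 2) s s' ∧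
          (s'.foundCircuit = true ∧ (∃ x, Relation.TransGen (Calls G s.f) x x) ∨
            Sound G I O k s' ∧
            (∀ x, s'.status x = .incomplete ↔ s.status x = .incomplete ∧ x ≠ w) ∧
            (∀ x, s.status x = .incomplete → x ≠ w → s'.inf x = s.inf x) ∧
            (∀ x, s.status x = .complete → s'.status x = .complete) ∧
            s'.status w = .complete) := by
      intro S' s₁ hk hs₁ h₁ h₂ h₃ h₄ h₅ h₆ h₇ h₈
      refine (ih (fun y hy => hl y (by simp [hy])) S' s₁ hs₁ h₄ ((h₁ w).2 hw)
        (fun x hx => hk.f_eq ▸ hinc x ((h₁ x).1 hx)) (hk.f_eq ▸ h₅) (fun y hy => ?_)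
        (hk.f_eq ▸ h₈)).mono fun _ s' ⟨hk', hr⟩ => ⟨(hk.trans hk').of_le ?_, ?_⟩
      · rw [hk.f_eq]
        rcases hSl y hy with h | h
        · rcases List.mem_cons.1 h with rfl | h
          · exact .inr h₇
          · exact .inl h
        · exact .inr fun v hv => h₆ v (h v hv)
      · rw [List.length_cons, Nat.mul_succ]
        omega
      · rw [hk.f_eq] at hr
        refine hr.imp_right fun ⟨r₁, r₂, r₃, r₄, r₅⟩ => ⟨r₁, fun x => ?_, fun x hx hxw => ?_,
          fun x hx => r₄ x (h₃ x hx), r₅⟩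
        · rw [r₂ x, h₁ x]
        · rw [r₃ x ((h₁ x).2 hx) hxw, h₂ x hx hxw]
    -- continue without a call
    have skip : ∀ n ≤ 11, (∀ v, ¬ CallsVia s.f w z v) →
        Runs (predLoop find k w l) { s with steps := s.steps + n } fun _ s' =>
          Kept D k ((5 * k + 11) * (z :: l).length + 2) s s' ∧
          (s'.foundCircuit = true ∧ (∃ x, Relation.TransGen (Calls G s.f) x x) ∨
            Sound G I O k s' ∧
            (∀ x, s'.status x = .incomplete ↔ s.status x = .incomplete ∧ x ≠ w) ∧
            (∀ x, s.status x = .incomplete → x ≠ w → s'.inf x = s.inf x) ∧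
            (∀ x, s.status x = .complete → s'.status x = .complete) ∧
            s'.status w = .complete) := fun n hn hno =>
      next S _ ((Kept.tick n).of_le (by omega)) { hs with } (fun _ => Iff.rfl)
        (fun _ _ _ => rfl) (fun _ h => h) hd hS (fun _ h => h)
        (fun v hv => absurd hv (hno v)) hinf
    -- a call for `v`, and what follows it
    have call : ∀ v, ∀ n ≤ 6, CallsVia s.f w z v → (∀ u, CallsVia s.f w z u → u = v) →
        Runs (find v) { s with steps := s.steps + n } fun _ s₁ =>
          Runs (do
            if ← getFoundCircuit then
              pure ()
            else
              augmentInf k w v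
              predLoop find k w l) s₁ fun _ s' =>
          Kept D k ((5 * k + 11) * (z :: l).length + 2) s s' ∧
          (s'.foundCircuit = true ∧ (∃ x, Relation.TransGen (Calls G s.f) x x) ∨
            Sound G I O k s' ∧
            (∀ x, s'.status x = .incomplete ↔ s.status x = .incomplete ∧ x ≠ w) ∧
            (∀ x, s.status x = .incomplete → x ≠ w → s'.inf x = s.inf x) ∧
            (∀ x, s.status x = .complete → s'.status x = .complete) ∧
            s'.status w = .complete) := by
      intro v n hn hv huniq
      have hvw : Calls G s.f v w := ⟨z, hwz, hv⟩
      refine (hfind v { s with steps := s.steps + n } { hs with } hd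
        fun x hx => Relation.TransGen.head' hvw (hinc x hx)).mono fun _ s₁ ⟨hk, hr⟩ => ?_
      have hk₁ : Kept D k (n + 3) s s₁ := (Kept.tick n).trans hk
      simp only [runs_bind, getFoundCircuit, runs_load, runs_ite, runs_pure]
      rcases hr with ⟨hf, hx⟩ | ⟨hs₁, hc, hcv⟩
      · rw [if_pos hf]
        refine ⟨(hk₁.trans (Kept.tick 1)).of_le ?_, .inl ⟨hf, hx⟩⟩
        rw [List.length_cons, Nat.mul_succ]
        omega
      · rw [if_neg (by simp [hs₁.notFound])]
        have hw₁ : s₁.status w = .incomplete := (hc.incomplete w).2 hw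
        have hne : v ≠ w := by
          rintro rfl
          simp [hcv] at hw₁
        refine (runs_augmentInf k hne _).mono ?_
        rintro _ _ ⟨inf, m, hm, rfl, hi₁, hi₂⟩
        have hinfw : ∀ u, (s₁.dist u : ℤ) ≤ inf w (s₁.path u) ↔
            (s₁.dist u : ℤ) ≤ s₁.inf w (s₁.path u) ∨ (s₁.dist u : ℤ) ≤ s₁.inf v (s₁.path u) := by
          intro u
          rw [hi₂ _ (hs₁.path_pos u) (hs₁.path_le u)]
          exact le_max_iff
        have hnw : ∀ x, s₁.status x ≠ .incomplete → inf x = s₁.inf x := fun x hx =>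
          hi₁ x (by rintro rfl; exact hx hw₁)
        refine next (fun u => S u ∨ u = v) _ (((hk₁.trans (Kept.tick (1 + m))).of_le
          (by omega)).trans (b' := 0) ⟨rfl, rfl, rfl, rfl, ?_⟩)
          { hs₁ with
            initial := fun x hx => ?_
            infima := fun x hx => ?_ } hc.incomplete ?_ hc.mono
          (hc.card_untouched_le.trans_lt hd) ?_ (fun _ h => .inl h)
          (fun u hu => .inr (huniq u hu)) fun u => ?_
        · simp [infimaPotential, untouched, Nat.add_assoc]
        · dsimp only at hx ⊢
          rw [hnw x (by simp [hx])]
          exact hs₁.initial x hx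
        · dsimp only at hx ⊢
          rw [hnw x (by simp [hx])]
          exact hs₁.infima x hx
        · intro x hx hxw
          exact (hi₁ x hxw).trans (hc.inf_eq x hx)
        · rintro u (hu | rfl)
          · exact ⟨(hS u hu).1, hc.mono u (hS u hu).2⟩
          · exact ⟨hvw, hcv⟩
        · refine (hinfw u).trans ?_
          rw [hs₁.infima v hcv u, hc.inf_eq w hw, hk₁.f_eq, hk₁.dist_eq, hk₁.path_eq]
          dsimp only
          rw [hinf u]
          simp only [or_and_right, exists_or, exists_eq_left, or_assoc]
    rw [predLoop]
    simp only [runs_bind, runs_step, getF, getG, runs_load, runs_test, runs_ite,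
      decide_eq_true_eq]
    have hg : ∀ x, s.g w = some x ↔ s.f x = some w := fun x => (hs.family.inverse x w).symm
    split_ifs with h₁ h₂
    · exact skip 3 (by omega) fun v hv => hv.1 h₁
    · rw [hg] at h₂
      have := call z 5 (by omega) ⟨h₁, .inl ⟨h₂, rfl⟩⟩ fun u hu =>
        hu.2.elim (fun h => h.2) fun h => absurd h₂ h.1
      simpa only [runs_bind, runs_ite] using this
    · rw [hg] at h₂
      cases hz : s.g z with
      | none =>
        refine skip 6 (by omega) fun v hv => ?_
        rcases hv.2 with h | h
        · exact h₂ h.1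
        · have := (hs.family.inverse v z).1 h.2
          simp [hz] at this
      | some v =>
        have := call v 6 (by omega) ⟨h₁, .inr ⟨h₂, (hs.family.inverse v z).2 hz⟩⟩ fun u hu => by
          rcases hu.2 with h | h
          · exact absurd h.1 h₂
          · exact hs.family.inj h.2 ((hs.family.inverse v z).2 hz)
        simpa only [runs_bind, runs_ite] using this

theorem findSpec_findInfima (D : Input G I O) (k d : ℕ) : FindSpec D k d (findInfima D k d) := by
  induction d with
  | zero => exact fun w s _ hd => absurd hd (Nat.not_lt_zero _)
  | succ d ih =>
    intro w s hs hd hinc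
    rw [findInfima]
    simp only [runs_bind, runs_step, getStatus, runs_load]
    cases hw : s.status w with
    | incomplete =>
      simp only [setFoundCircuit, runs_store]
      exact ⟨(Kept.tick 3).trans (b' := 0) ⟨rfl, rfl, rfl, rfl, le_rfl⟩,
        .inl ⟨trivial, w, hinc w hw⟩⟩
    | complete =>
      simp only [runs_pure]
      exact ⟨(Kept.tick 2).of_le (by omega),
        .inr ⟨{ hs with }, ⟨fun _ => Iff.rfl, fun _ _ => rfl, fun _ h => h⟩, hw⟩⟩
    | untouched =>
      simp only [runs_bind, setStatus, runs_store]
      have hwu : w ∈ untouched s := mem_untouched.2 hw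
      have hinc₁ : ∀ x, Function.update s.status w .incomplete x = .incomplete ↔
          x = w ∨ s.status x = .incomplete := by
        intro x
        by_cases e : x = w
        · subst e; simp
        · simp [e]
      have hcomp : ∀ x, Function.update s.status w .incomplete x = .complete ↔
          s.status x = .complete := by
        intro x
        by_cases e : x = w
        · subst e; simp [hw]
        · simp [e]
      have hunt : ∀ x, Function.update s.status w .incomplete x = .untouched ↔
          x ≠ w ∧ s.status x = .untouched := by
        intro x
        by_cases e : x = w
        · subst e; simp
        · simp [e]
      let s₁ : Memory V := { s with
        status := Function.update s.status w .incomplete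
        steps := s.steps + 3 }
      have hfresh : untouched s₁ = (untouched s).erase w := by
        ext x
        rw [Finset.mem_erase, mem_untouched, mem_untouched]
        exact hunt x
      have hpot : infimaPotential D k s₁ + ((5 * k + 11) * (D.nbrs w).length + 2) =
          infimaPotential D k s + 3 := by
        have := Finset.sum_erase_add (untouched s)
          (fun x => (5 * k + 11) * (D.nbrs x).length + 2) hwu
        simp only [infimaPotential, hfresh]
        change s.steps + 3 + _ + _ = _
        omega
      have hcard := Finset.card_erase_add_one hwu
      have hs₁ : Sound G I O k s₁ :=
        { hs with
          initial := fun x hx => hs.initial x ((hunt x).1 hx).2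
          acc := fun x hx => hs.acc x ((hcomp x).1 hx)
          complete := fun x hx v hv => (hcomp v).2 (hs.complete x ((hcomp x).1 hx) v hv)
          infima := fun x hx => hs.infima x ((hcomp x).1 hx) }
      refine (runs_predLoop ih w (D.nbrs w) (fun z hz => (D.mem_nbrs w z).1 hz) (fun _ => False)
        s₁ hs₁ (by rw [hfresh]; omega) (by simp [s₁]) (fun x hx => ?_) (fun v hv => hv.elim)
        (fun z hz => .inl ((D.mem_nbrs w z).2 hz)) (fun v => ?_)).mono
        fun _ s' ⟨hk, hr⟩ => ⟨⟨hk.f_eq, hk.g_eq, hk.dist_eq, hk.path_eq, ?_⟩, ?_⟩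
      · rcases (hinc₁ x).1 hx with rfl | hx
        · exact .refl
        · exact (hinc x hx).to_reflTransGen
      · simpa using hs.initial w hw v
      · have := hk.potential
        omega
      · refine hr.imp_right fun ⟨r₁, r₂, r₃, r₄, r₅⟩ => ⟨r₁, ⟨fun x => ?_, fun x hx => ?_,
          fun x hx => r₄ x ((hcomp x).2 hx)⟩, r₅⟩
        · rw [r₂ x]
          by_cases e : x = w
          · subst e; simp [hw]
          · simp [s₁, e]
        · have e : x ≠ w := by rintro rfl; simp [hw] at hx
          exact r₃ x ((hinc₁ x).2 (.inr hx)) e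

theorem runs_findInfimaLoop (D : Input G I O) (k d : ℕ) (hd : Fintype.card V < d) (l : List V)
    (s : Memory V) (hs : Sound G I O k s) (hinc : ∀ x, s.status x ≠ .incomplete) :
    Runs (findInfimaLoop D k d l) s fun r s' => Kept D k (5 * l.length + 1) s s' ∧
      (r = false ∧ (∃ x, Relation.TransGen (Calls G s.f) x x) ∨
        r = true ∧ Sound G I O k s' ∧ (∀ x, s.status x = .complete → s'.status x = .complete) ∧
        ∀ w ∈ l, s'.status w = .complete) := by
  induction l generalizing s with
  | nil =>
    rw [findInfimaLoop]
    simp only [runs_bind, runs_step, runs_pure]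
    exact ⟨Kept.tick 1, .inr ⟨trivial, { hs with }, fun _ h => h, by simp⟩⟩
  | cons w l ih =>
    rw [findInfimaLoop]
    simp only [runs_bind, runs_step, getFoundCircuit, runs_load, runs_ite, runs_pure]
    refine (findSpec_findInfima D k d w { s with steps := s.steps + 1 } { hs with }
      ((Finset.card_le_univ _).trans_lt hd) fun x hx => absurd hx (hinc x)).mono
      fun _ s₁ ⟨hk, hr⟩ => ?_
    have hk₁ : Kept D k 5 s { s₁ with steps := s₁.steps + 1 } :=
      ((Kept.tick 1).trans hk).trans (Kept.tick 1)
    rcases hr with ⟨hf, hx⟩ | ⟨hs₁, hc, hcw⟩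
    · rw [if_pos hf]
      exact ⟨hk₁.of_le (by rw [List.length_cons]; omega), .inl ⟨trivial, hx⟩⟩
    · rw [if_neg (by simp [hs₁.notFound])]
      refine (ih { s₁ with steps := s₁.steps + 1 } { hs₁ with }
        fun x hx => hinc x ((hc.incomplete x).1 hx)).mono fun _ s' ⟨hk', hr⟩ => ⟨(hk₁.trans hk').of_le (by rw [List.length_cons]; omega), ?_⟩
      have hf₁ : s₁.f = s.f := hk.f_eq
      dsimp only at hr
      rw [hf₁] at hr
      refine hr.imp_right fun ⟨r₁, r₂, r₃, r₄⟩ => ⟨r₁, r₂, fun x hx => r₃ x (hc.mono x hx),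
        fun u hu => ?_⟩
      rcases List.mem_cons.1 hu with rfl | hu
      · exact r₃ u hcw
      · exact r₄ u hu

end FindInfima

section NaturalPreorder

variable {V : Type} {G : SimpleGraph V} {I O : Finset V} {k d : ℕ}

theorem exists_reaches_out {f : V → Option V} (hf : Acyclic f) (hmap : IsMapCompl I O f) (x : V) :
    ∃ w ∈ O, f w = none ∧ Reaches f x w := by
  induction x using hf.induction with
  | _ x ih =>
    cases hx : f x with
    | none => exact ⟨x, (hmap.dom x).1 hx, hx, .refl⟩
    | some y =>
      obtain ⟨w, hw, hfw, h⟩ := ih y hx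
      exact ⟨w, hw, hfw, .head hx h⟩

theorem Sound.complete_of_reaches {s : Memory V} (h : Sound G I O k s) {x w : V}
    (hw : s.status w = .complete) (hx : Reaches s.f x w) : s.status x = .complete := by
  induction hx using Relation.ReflTransGen.head_induction_on with
  | refl => exact hw
  | head hab _ ih => exact h.complete _ ih _ (h.family.calls_of_some hab)

theorem Sound.antisymm {s : Memory V} (h : Sound G I O k s)
    (hall : ∀ x, s.status x = .complete) (v w : V) (hvw : NaturalPreorder G s.f v w)
    (hwv : NaturalPreorder G s.f w v) : v = w := by
  rw [h.family.naturalPreorder_eq] at hvw hwv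
  have hwf : WellFounded (Relation.TransGen (Calls G s.f)) :=
    WellFounded.transGen ⟨fun x => h.acc x (hall x)⟩
  rcases Relation.reflTransGen_iff_eq_or_transGen.1 hvw with e | hvw
  · exact e.symm
  · exact absurd (Relation.TransGen.trans_left hvw hwv) (hwf.irrefl.irrefl v)

variable [Fintype V]

theorem Sound.of_labelled {P : ℕ} {s : Memory V} (hfam : IsFamily G I O s.f s.g)
    (hmap : IsMapCompl I O s.f) (h : Labelled k (fun _ => True) P s) (hP : P ≤ k + 1)
    (hc : s.foundCircuit = false) : Sound G I O k s where
  family := hfam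
  path_pos x := h.pos x trivial
  path_le x := Nat.le_of_lt_succ ((h.lt x trivial).trans_le hP)
  notFound := hc
  initial x _ v := by
    have hv := h.initialized v trivial
    have hx := h.initialized x trivial
    rw [hx.inf _ (h.pos v trivial) (Nat.le_of_lt_succ ((h.lt v trivial).trans_le hP))]
    constructor
    · intro hle
      split_ifs at hle with hp
      · obtain ⟨w, -, hvw, hxw⟩ := (h.samePath v x trivial trivial).1 hp
        refine reaches_of_card_le (fun _ _ _ => hfam.inj) hvw hxw ?_
        rw [← hv.dist, ← hx.dist]
        omega
      · omega
    · intro hvx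
      obtain ⟨w, -, hw, hxw⟩ := exists_reaches_out hfam.acyclic hmap x
      rw [if_pos ((h.samePath v x trivial trivial).2 ⟨w, hw, hvx.trans hxw, hxw⟩)]
      have hsub : segment s.f v ⊆ segment s.f x := fun u hu =>
        mem_segment.2 ((mem_segment.1 hu).trans hvx)
      have := Finset.card_le_card hsub
      rw [← hv.dist, ← hx.dist] at this
      omega
  acc x hx := by simp [(h.initialized x trivial).status] at hx
  complete x hx := by simp [(h.initialized x trivial).status] at hx
  infima x hx := by simp [(h.initialized x trivial).status] at hx

theorem sum_card_segment_le {f : V → Option V} (l : List V) (hnd : l.Nodup)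
    (hl : ∀ w ∈ l, f w = none) : (l.map fun w => (segment f w).card).sum ≤ Fintype.card V := by
  classical
  rw [← List.sum_toFinset _ hnd, ← Finset.card_biUnion]
  · exact Finset.card_le_univ _
  · intro w hw w' hw' hne
    refine Finset.disjoint_left.2 fun x hx hx' => hne ?_
    exact reaches_end_unique (hl w (List.mem_toFinset.1 hw)) (hl w' (List.mem_toFinset.1 hw'))
      (mem_segment.1 hx) (mem_segment.1 hx')

variable [DecidableEq V]

theorem runs_testNaturalPreorder (D : Input G I O) (hk : D.outs.length = k)
    (hd : Fintype.card V < d) (s : Memory V) (hfam : IsFamily G I O s.f s.g)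
    (hmap : IsMapCompl I O s.f) :
    Runs (testNaturalPreorder D k d) s fun r s' => s'.f = s.f ∧ s'.g = s.g ∧
      s'.steps ≤ s.steps + (9 * k + 6) + (4 * k + 9) * Fintype.card V +
        (5 * k + 11) * ∑ x, (D.nbrs x).length ∧
      (r = none ∧ (∃ x, Relation.TransGen (Calls G s.f) x x) ∨
        ∃ T, r = some T ∧ T.IsSystemFor (NaturalPreorder G s.f) ∧
          ∀ v w, NaturalPreorder G s.f v w → NaturalPreorder G s.f w v → v = w) := by
  have hout : ∀ w ∈ D.outs, s.f w = none := fun w hw => (hmap.dom w).2 ((D.mem_outs w).1 hw)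
  rw [testNaturalPreorder]
  simp only [runs_bind, runs_step, setNextPath, setFoundCircuit, runs_store]
  refine (runs_forEach_initializePath k d D.outs D.outs_nodup 1 (fun _ => False)
    { s with nextPath := 1, steps := s.steps + 2 } hfam.acyclic hfam.inverse le_rfl rfl hout hd.le
    (fun _ _ h => h.elim) ⟨fun _ h => h.elim, fun _ h => h.elim, fun _ h => h.elim,
      fun _ _ h => h.elim⟩).mono fun _ s₁ ⟨hf₁, hg₁, hlab, hsteps⟩ => ?_
  dsimp only at hf₁ hg₁ hlab hsteps
  have hall : (fun x => False ∨ ∃ w ∈ D.outs, Reaches s.f x w) = fun _ => True := by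
    funext x
    obtain ⟨w, hw, -, hxw⟩ := exists_reaches_out hfam.acyclic hmap x
    exact eq_true (.inr ⟨w, (D.mem_outs w).2 hw, hxw⟩)
  rw [hall] at hlab
  have hlab' : Labelled k (fun _ => True) (1 + D.outs.length)
      { s₁ with foundCircuit := false, steps := s₁.steps + 1 } :=
    ⟨fun x hx => SameAt.initialized (s := s₁) ⟨rfl, rfl, rfl, rfl⟩ rfl (hlab.initialized x hx),
      hlab.pos, hlab.lt, hlab.samePath⟩
  have hsound := Sound.of_labelled (G := G) (I := I) (O := O) (k := k)
    (s := { s₁ with foundCircuit := false, steps := s₁.steps + 1 })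
    (by dsimp only; rw [hf₁, hg₁]; exact hfam) (by dsimp only; rw [hf₁]; exact hmap) hlab'
    (by omega) rfl
  refine (runs_findInfimaLoop D k d hd D.outs _ hsound fun x => ?_).mono
    fun r s₂ ⟨hkept, hr⟩ => ?_
  · rw [(hlab'.initialized x trivial).status]
    simp
  have hpot : infimaPotential D k { s₁ with foundCircuit := false, steps := s₁.steps + 1 } ≤
      s₁.steps + 1 + ((5 * k + 11) * ∑ x, (D.nbrs x).length + 2 * Fintype.card V) := by
    refine Nat.add_le_add_left ((Finset.sum_le_sum_of_subset (Finset.subset_univ _)).trans ?_) _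
    rw [Finset.sum_add_distrib, Finset.mul_sum]
    simp [mul_comm]
  have hbound : s₂.steps + 1 ≤ s.steps + (9 * k + 6) + (4 * k + 9) * Fintype.card V +
      (5 * k + 11) * ∑ x, (D.nbrs x).length := by
    have h₁ := Nat.mul_le_mul_left (4 * k + 7) (sum_card_segment_le D.outs D.outs_nodup hout)
    have h₂ := hkept.potential
    have h₃ : s₂.steps ≤ infimaPotential D k s₂ := Nat.le_add_right _ _
    have h₄ : (4 * k + 9) * Fintype.card V =
      (4 * k + 7) * Fintype.card V + 2 * Fintype.card V := by ring
    rw [hk] at hsteps h₂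
    omega
  have hf₂ : s₂.f = s.f := hkept.f_eq.trans hf₁
  have hg₂ : s₂.g = s.g := hkept.g_eq.trans hg₁
  dsimp only at hr
  rw [hf₁] at hr
  rcases hr with ⟨rfl, hx⟩ | ⟨rfl, hs₂, -, hcomp⟩
  · simp only [runs_pure, Bool.false_eq_true, if_false]
    exact ⟨hf₂, hg₂, by omega, .inl ⟨trivial, hx⟩⟩
  · simp only [runs_pure, runs_bind, runs_load, if_true]
    have hcomplete : ∀ x, s₂.status x = .complete := by
      intro x
      obtain ⟨w, hw, -, hxw⟩ := exists_reaches_out hfam.acyclic hmap x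
      exact hs₂.complete_of_reaches (hcomp w ((D.mem_outs w).2 hw)) (hf₂ ▸ hxw)
    refine ⟨hf₂, hg₂, hbound, .inr ⟨_, rfl, fun v w => ?_, ?_⟩⟩
    · rw [← hf₂]
      exact (hs₂.infima w (hcomplete w) v).symm
    · rw [← hf₂]
      exact hs₂.antisymm hcomplete

end NaturalPreorder

/-! ### The complete procedure -/

section FindFlow

variable {V : Type} {G : SimpleGraph V} {I O : Finset V}

theorem runs_count {α : Type} (l : List α) (s : Memory V) :
    Runs (count l) s fun n s' =>
      n = l.length ∧ s' = { s with steps := s.steps + (l.length + 1) } := by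
  induction l generalizing s with
  | nil =>
    rw [count]
    simp only [runs_bind, runs_step, runs_pure]
    exact ⟨rfl, rfl⟩
  | cons a l ih =>
    rw [count]
    simp only [runs_bind, runs_step, runs_pure]
    refine (ih _).mono ?_
    rintro _ _ ⟨rfl, rfl⟩
    exact ⟨rfl, by simp; omega⟩

theorem runs_sumDeg (D : Input G I O) (l : List V) (s : Memory V) :
    Runs (sumDeg D l) s fun m s' =>
      m = (l.map D.deg).sum ∧ s' = { s with steps := s.steps + (l.length + 1) } := by
  induction l generalizing s with
  | nil =>
    rw [sumDeg]
    simp only [runs_bind, runs_step, runs_pure]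
    exact ⟨rfl, rfl⟩
  | cons a l ih =>
    rw [sumDeg]
    simp only [runs_bind, runs_step, runs_pure]
    refine (ih _).mono ?_
    rintro _ _ ⟨rfl, rfl⟩
    exact ⟨by simp [add_comm], by simp; omega⟩

variable [DecidableEq V]

theorem runs_testPathCoverLoop (D : Input G I O) (l : List V) (s : Memory V) :
    Runs (testPathCoverLoop D l) s fun r s' =>
      (∃ n ≤ 4 * l.length + 1, s' = { s with steps := s.steps + n }) ∧
      (r = true ↔ ∀ v ∈ l, ¬ (v ∈ I ∧ v ∈ O) → s.f v = none → s.g v ≠ none) := by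
  induction l generalizing s with
  | nil =>
    rw [testPathCoverLoop]
    simp only [runs_bind, runs_step, runs_pure]
    exact ⟨⟨1, by simp, rfl⟩, by simp⟩
  | cons v l ih =>
    rw [testPathCoverLoop]
    simp only [runs_bind, runs_step, runs_pure, getF, getG, runs_load, runs_test, runs_ite,
      decide_eq_true_eq, D.isIn_iff, D.isOut_iff]
    split_ifs with h
    · refine ⟨⟨4, by rw [List.length_cons]; omega, rfl⟩, iff_of_false (by simp) fun hall => ?_⟩
      exact hall v (by simp) h.1 h.2.1 h.2.2
    · refine (ih _).mono ?_
      rintro r _ ⟨⟨n, hn, rfl⟩, hr⟩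
      refine ⟨⟨4 + n, by rw [List.length_cons]; omega, by simp; omega⟩, hr.trans ?_⟩
      simp only [List.forall_mem_cons]
      exact ⟨fun hall => ⟨fun h₁ h₂ h₃ => h ⟨h₁, h₂, h₃⟩, hall⟩, fun hall => hall.2⟩

theorem Input.length_outs (D : Input G I O) : D.outs.length = O.card := by
  rw [← List.toFinset_card_of_nodup D.outs_nodup]
  congr 1
  ext v
  rw [List.mem_toFinset, D.mem_outs]

variable [Fintype V]

theorem Input.length_verts (D : Input G I O) : D.verts.length = Fintype.card V := by
  rw [← List.toFinset_card_of_nodup D.verts_nodup, ← Finset.card_univ]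
  exact congrArg _ (Finset.eq_univ_of_forall fun v => List.mem_toFinset.2 (D.mem_verts v))

theorem Input.sum_deg (D : Input G I O) :
    (D.verts.map D.deg).sum = ∑ v, (D.nbrs v).length := by
  rw [← List.sum_toFinset _ D.verts_nodup]
  have : D.verts.toFinset = Finset.univ :=
    Finset.eq_univ_of_forall fun v => List.mem_toFinset.2 (D.mem_verts v)
  rw [this]
  exact Finset.sum_congr rfl fun v _ => D.deg_eq v

theorem Input.sum_length_nbrs (D : Input G I O) [DecidableRel G.Adj] :
    ∑ v, (D.nbrs v).length = (Finset.univ.filter fun p : V × V => G.Adj p.1 p.2).card := by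
  rw [Finset.card_filter, Fintype.sum_prod_type]
  refine Finset.sum_congr rfl fun v _ => ?_
  rw [← Finset.card_filter, ← List.toFinset_card_of_nodup (D.nbrs_nodup v)]
  congr 1
  ext w
  simp [D.mem_nbrs]

/-- A geometry with too many edges has no flow. -/
theorem Input.not_hasFlow (D : Input G I O) (hc : I.card = O.card)
    (h : (((∑ v, (D.nbrs v).length) / 2 : ℕ) : ℤ) >
      (O.card : ℤ) * Fintype.card V - ((O.card + 1).choose 2 : ℕ)) : ¬ HasFlow G I O := by
  classical
  rintro ⟨F, r, hF⟩
  have h₁ := hF.card_adj_le hc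
  rw [← D.sum_length_nbrs] at h₁
  have h₂ : (O.card + 1).choose 2 * 2 = O.card * (O.card + 1) := by
    rw [Nat.choose_two_right, Nat.add_sub_cancel, mul_comm (O.card + 1)]
    exact Nat.div_mul_cancel (Nat.even_mul_succ_self _).two_dvd
  zify at h₁ h₂
  have h₃ : 2 * (((∑ v, (D.nbrs v).length) / 2 : ℕ) : ℤ) ≤ ((∑ v, (D.nbrs v).length : ℕ) : ℤ) := by
    exact_mod_cast Nat.mul_div_le _ 2
  push_cast at h h₃
  linarith

/-- The bound on the number of edges turns the number of steps into a multiple of `k ^ 2 * n`. -/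
theorem findFlow_steps_le {k n m S : ℕ} (hk : 1 ≤ k) (hkn : k ≤ n) (hm : m ≤ 2 * (k * n) + 1)
    (hS : S ≤ 19 * n + 20 * k + 30 + (k + 1) * (5 * k + 6 + (12 * m + 12 * n)) +
      (4 * k + 9) * n + (5 * k + 11) * m) : S ≤ 400 * (k ^ 2 * n) := by
  have h₁ : k * m ≤ 2 * (k ^ 2 * n) + k := by nlinarith
  have h₂ : k * n ≤ k ^ 2 * n := Nat.mul_le_mul_right n (Nat.le_self_pow two_ne_zero k)
  have h₃ : n ≤ k * n := Nat.le_mul_of_pos_left n hk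
  have h₄ : k * k ≤ k * n := Nat.mul_le_mul_left k hkn
  nlinarith

theorem runs_findFlow (D : Input G I O) (hc : I.card = O.card) {d : ℕ}
    (hd : Fintype.card V < d) (s : Memory V) :
    Runs (findFlow D d) s fun res s' =>
      (1 ≤ O.card → s'.steps ≤ s.steps + 400 * (O.card ^ 2 * Fintype.card V)) ∧
      (res = none ↔ ¬ HasFlow G I O) ∧
      ∀ f g T, res = some (f, g, T) →
        IsSuccessorFunction G I O f ∧ IsInverse f g ∧ T.IsSystemFor (NaturalPreorder G f) ∧
        IsFlow G I O f (NaturalPreorder G f) := by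
  have hkn : O.card ≤ Fintype.card V := Finset.card_le_univ O
  rw [findFlow]
  simp only [runs_bind, runs_step]
  refine (runs_count D.verts _).mono ?_
  rintro _ _ ⟨rfl, rfl⟩
  refine (runs_sumDeg D D.verts _).mono ?_
  rintro _ _ ⟨rfl, rfl⟩
  refine (runs_count D.outs _).mono ?_
  rintro _ _ ⟨rfl, rfl⟩
  simp only [runs_test, runs_ite, runs_pure, decide_eq_true_eq]
  rw [D.length_verts, D.length_outs, D.sum_deg]
  split_ifs with hm
  · refine ⟨fun hk => ?_, iff_of_true trivial (D.not_hasFlow hc hm), by simp⟩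
    have := findFlow_steps_le (m := 0) (S := 4 + 2 * Fintype.card V + O.card + 1) hk hkn
      (by omega) (by nlinarith)
    omega
  have hm' : ∑ v, (D.nbrs v).length ≤ 2 * (O.card * Fintype.card V) + 1 := by
    have : (∑ v, (D.nbrs v).length) / 2 ≤ O.card * Fintype.card V := by
      zify
      push_cast at hm ⊢
      have : (0 : ℤ) ≤ ((O.card + 1).choose 2 : ℕ) := Int.natCast_nonneg _
      linarith
    omega
  refine (runs_bind.2 <| (runs_obtainMaxFamilyPaths D hd.le (hkn.trans_lt hd) _).mono
    fun _ s₁ ⟨hfam, ⟨T, hT, hTO⟩, hsteps₁⟩ => ?_)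
  -- if a flow exists, the paths found cover `O`, so that they are those of the flow
  have heq : ∀ F r, IsFlow G I O F r → (∀ v ∈ O, v ∉ I → s₁.g v ≠ none) ∧ s₁.f = F := by
    intro F r hF
    have hcov : ∀ v ∈ O, v ∉ I → s₁.g v ≠ none := fun v hv hvI hg =>
      hF.not_searchClosed hc hfam hT (hTO v hv hvI hg) hg
    exact ⟨hcov, hF.eq_of_covered hfam hcov⟩
  rw [runs_bind]
  refine (runs_testPathCoverLoop D D.verts s₁).mono ?_
  rintro b _ ⟨⟨n, hn, rfl⟩, hb⟩
  have hsum : ∑ x, 12 * ((D.nbrs x).length + 1) =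
      12 * ∑ x, (D.nbrs x).length + 12 * Fintype.card V := by
    simp only [← Finset.mul_sum, Finset.sum_add_distrib, Finset.sum_const, Finset.card_univ,
      smul_eq_mul]
    ring
  rw [D.length_verts, D.length_outs, hsum] at hsteps₁
  rw [D.length_verts] at hn
  dsimp only at hsteps₁
  rw [runs_ite]
  split_ifs with hbt
  swap
  · rw [runs_pure]
    refine ⟨fun hk => ?_, iff_of_true rfl ?_, by simp⟩
    · have := findFlow_steps_le (S := 10 * Fintype.card V + O.card + 9 + (O.card + 1) *
        (5 * O.card + 6 + (12 * ∑ x, (D.nbrs x).length + 12 * Fintype.card V))) hk hkn hm'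
        (by omega)
      dsimp only
      omega
    · rintro ⟨F, r, hF⟩
      obtain ⟨hcov, rfl⟩ := heq F r hF
      refine hbt (hb.2 fun v _ hv hfv => ?_)
      have hvO := (hF.map.dom v).1 hfv
      exact hcov v hvO fun hvI => hv ⟨hvI, hvO⟩
  have hmap : IsMapCompl I O s₁.f := by
    refine ⟨fun v => ⟨fun hfv => ?_, fun hvO => ?_⟩, hfam.notMem_in⟩
    · by_contra hvO
      have hgv := hb.1 hbt v (D.mem_verts v) (fun h => hvO h.2) hfv
      obtain ⟨u, hu⟩ := Option.ne_none_iff_exists'.1 hgv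
      have hvI := hfam.notMem_in u v ((hfam.inverse u v).2 hu)
      exact hgv ((hfam.free v hvI hvO).1 hfv)
    · by_contra hne
      obtain ⟨y, hy⟩ := Option.ne_none_iff_exists'.1 hne
      exact hfam.notMem_out v y hy hvO
  rw [runs_bind]
  refine (runs_testNaturalPreorder D D.length_outs hd { s₁ with steps := s₁.steps + n }
    hfam hmap).mono fun r s₂ ⟨hf₂, hg₂, hsteps₂, hr⟩ => ?_
  have hbound : 1 ≤ O.card →
      s₂.steps + 1 ≤ s.steps + 400 * (O.card ^ 2 * Fintype.card V) := by
    intro hk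
    have := findFlow_steps_le (S := 10 * Fintype.card V + O.card + 9 + (O.card + 1) *
        (5 * O.card + 6 + (12 * ∑ x, (D.nbrs x).length + 12 * Fintype.card V)) + (9 * O.card + 7) +
        (4 * O.card + 9) * Fintype.card V + (5 * O.card + 11) * ∑ x, (D.nbrs x).length)
      hk hkn hm' (by omega)
    dsimp only at hsteps₂
    omega
  dsimp only at hf₂ hg₂ hr
  rcases hr with ⟨rfl, x, hx⟩ | ⟨T, rfl, hsys, hanti⟩
  · simp only [runs_pure]
    refine ⟨fun hk => (Nat.le_succ _).trans (hbound hk), iff_of_true trivial ?_, by simp⟩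
    rintro ⟨F, r, hF⟩
    obtain rfl := (heq F r hF).2
    obtain ⟨y, hxy, hyx⟩ := Relation.TransGen.head'_iff.1 hx
    have hinf := influences_of_calls hxy
    refine hinf.1 (hF.antisymm x y (hF.naturalPreorder_le (.single hinf))
      (hF.naturalPreorder_le ?_))
    rw [hfam.naturalPreorder_eq]
    exact hyx
  · simp only [runs_bind, runs_load, runs_pure]
    have hflow := isFlow_naturalPreorder hmap hfam.adj hanti
    refine ⟨hbound, iff_of_false (by simp) (not_not.2 ⟨_, _, hflow⟩), ?_⟩
    rintro f g T' h
    simp only [Option.some.injEq, Prod.mk.injEq] at h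
    obtain ⟨rfl, rfl, rfl⟩ := h
    rw [hf₂, hg₂]
    exact ⟨isSuccessorFunction_of_acyclic hmap hfam.acyclic (fun _ _ _ => hfam.inj) hfam.adj,
      hfam.inverse, hsys, hflow⟩

end FindFlow

end FlowFinding

theorem mainTheorem4 :
    ∃ C : ℕ, ∀ (V : Type) [Fintype V] [DecidableEq V] (G : SimpleGraph V) (I O : Finset V)
      (n k : ℕ), Fintype.card V = n → I.card = k → O.card = k →
      ∀ (D : FlowFinding.Input G I O) (s : FlowFinding.Memory V), s.steps = 0 →
      ∃ (res : Option ((V → Option V) × (V → Option V) × FlowFinding.Infima V))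
        (s' : FlowFinding.Memory V),
        FlowFinding.Returns (FlowFinding.findFlow D) s res s' ∧
        (1 ≤ k → s'.steps ≤ C * (k ^ 2 * n)) ∧
        (res = none ↔ ¬ FlowFinding.HasFlow G I O) ∧
        (∀ (f g : V → Option V) (T : FlowFinding.Infima V), res = some (f, g, T) →
          FlowFinding.IsSuccessorFunction G I O f ∧
          FlowFinding.IsInverse f g ∧
          T.IsSystemFor (FlowFinding.NaturalPreorder G f) ∧
          FlowFinding.IsFlow G I O f (FlowFinding.NaturalPreorder G f)) := by
  refine ⟨400, ?_⟩
  rintro V _ _ G I O n k rfl hI rfl D s hs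
  obtain ⟨res, s', hret, hsteps, hres⟩ :=
    (FlowFinding.runs_findFlow D hI (Nat.lt_succ_self _) s).returns_findFlow
  exact ⟨res, s', hret, fun hk => by simpa [hs] using hsteps hk, hres⟩
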